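/- Let $n\ge 1$, $0<p<1$ and let $\Phi:\mathbb R^n\to\mathbb C$ be locally integrable on $\mathbb R^n\setminus\{0\}$. The Hausdorff operator is $$H_\Phi f(x)=\int_{\mathbb R^n}\Phi(y)\,f\!\left(\frac{x}{|y|}\right)dy .$$ Its natural domain $\mathrm{Dom}(H_\Phi)$ is the set of measurable $f:\mathbb R^n\to\mathbb C$ for which this integral converges absolutely for almost every $x$; it contains $C_c^\infty(\mathbb R^n\setminus\{0\})$. We write $H_\Phi=0$ if $H_\Phi f=0$ a.e. for every $f\in\mathrm{Dom}(H_\Phi)$. Let $X$ be one of the following spaces. * $L^p=L^p(\mathbb R^n)$. * The local Hardy space $h^p=\{u\in\mathscr S':\|u\|_{h^p}=\|\sup_{0<t<1}|\psi_t*u|\|_{L^p}<\infty\}$, where $\psi\in\mathscr S$ is any fixed function with $\int\psi\ne0$, and $\psi_t(x)=t^{-n}\psi(x/t)$. * The modulation space $M^{p,p}=\{u\in\mathscr S':\|u\|_{M^{p,p}}=(\sum_{k\in\mathbb Z^n}\|\mathscr F^{-1}\sigma_k\mathscr F u\|_{L^p}^p)^{1/p}<\infty\}$, where $\sigma_k(\xi)=\eta(\xi-k)/\sum_{l\in\mathbb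 Z^n}\eta(\xi-l)$ and $\eta:\mathbb R^n\to[0,1]$ is any fixed smooth function with $\eta=1$ for $|\xi|_\infty\le\frac12$ and $\eta=0$ for $|\xi|_\infty\ge\frac34$. * The Besov space $B^{p,p}=\{u\in\mathscr S':\|u\|_{B^{p,p}}=(\sum_{j\ge0}\|\Delta_ju\|_{L^p}^p)^{1/p}<\infty\}$ or the Triebel–Lizorkin space $F^{p,p}=\{u\in\mathscr S':\|u\|_{F^{p,p}}=\|(\sum_{j\ge0}|\Delta_ju|^p)^{1/p}\|_{L^p}<\infty\}$. Here $\Delta_j=\mathscr F^{-1}\phi_j\mathscr F$, $\phi_0=\varphi$, $\phi_j(\xi)=\varphi(2^{-j}\xi)-\varphi(2^{1-j}\xi)$ for $j\ge1$, and $\varphi$ is any fixed real-valued smooth function that vanishes for $|\xi|\ge\frac32$ and equals $1$ for $|\xi|\le\frac43$. Let $\mathcal D$ be any class of functions with $C_c^\infty(\mathbb R^n\setminus\{0\})\subset\mathcal D\subset\mathrm{Dom}(H_\Phi)$ (for instance either of the two extremes). Say that $H_\Phi$ is bounded on $X$ if there is a constant $C<\infty$ such that $H_\Phi f\in X$ and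 $\|H_\Phi f\|_X\le C\|f\|_X$ for all $f\in\mathcal D\cap X$; for the spaces $X\subset\mathscr S'$, a locally integrable function belongs to $X$ if, as a distribution, it is (the restriction to $C_c^\infty(\mathbb R^n)$ of) an element of $X$. Then, for each of the five choices $X=L^p,\ h^p,\ M^{p,p},\ B^{p,p},\ F^{p,p}$, $$H_\Phi\ \text{is bounded on}\ X\iff H_\Phi=0 .$$ -/

import Mathlib

open MeasureTheory SchwartzMap FourierTransform
open scoped ENNReal NNReal ContDiff

noncomputable section

namespace Hausdorff

/-- Euclidean space `ℝⁿ`. -/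
abbrev E (n : ℕ) : Type := EuclideanSpace ℝ (Fin n)

/-! ### The Hausdorff operator -/

/-- `H_Φ f (x) = ∫ Φ(y) f(x / |y|) dy`. -/
def hausdorff {n : ℕ} (Φ f : E n → ℂ) (x : E n) : ℂ :=
  ∫ y, Φ y * f (‖y‖⁻¹ • x)

/-- The natural (maximal) domain of `H_Φ`: the measurable functions `f` for which the integral
defining `H_Φ f (x)` converges absolutely for almost every `x`. -/
def naturalDomain {n : ℕ} (Φ : E n → ℂ) : Set (E n → ℂ) :=
  {f | AEStronglyMeasurable f volume ∧
    ∀ᵐ x : E n, Integrable (fun y : E n => Φ y * f (‖y‖⁻¹ • x)) volume}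

/-- `C_c^∞(ℝⁿ ∖ {0})`: smooth functions with compact support away from the origin. -/
def testFunctions (n : ℕ) : Set (E n → ℂ) :=
  {f | ContDiff ℝ ∞ f ∧ HasCompactSupport f ∧ (0 : E n) ∉ tsupport f}

/-- `H_Φ = 0`: the operator vanishes on its whole natural domain. -/
def IsZeroOperator {n : ℕ} (Φ : E n → ℂ) : Prop :=
  ∀ f ∈ naturalDomain Φ, hausdorff Φ f =ᵐ[volume] 0

/-! ### Tempered distributions: convolution, dilation, functions as distributions -/

/-- `(scale c ψ)(x) = ψ(c x)` for `c ≠ 0`. -/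
def scale {n : ℕ} (c : ℝ) (hc : c ≠ 0) (ψ : 𝓢(E n, ℂ)) : 𝓢(E n, ℂ) :=
  compCLMOfContinuousLinearEquiv ℂ
    (ContinuousLinearEquiv.smulLeft (R₁ := ℝ) (M₁ := E n) (Units.mk0 c hc)) ψ

theorem scale_apply {n : ℕ} (c : ℝ) (hc : c ≠ 0) (ψ : 𝓢(E n, ℂ)) (x : E n) :
    scale c hc ψ x = ψ (c • x) := rfl

/-- The Schwartz function `y ↦ ψ(x - y)`. -/
def reflectAt {n : ℕ} (ψ : 𝓢(E n, ℂ)) (x : E n) : 𝓢(E n, ℂ) :=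
  compSubConstCLM ℂ x
    (compCLMOfContinuousLinearEquiv ℂ (ContinuousLinearEquiv.neg ℝ (M := E n)) ψ)

theorem reflectAt_apply {n : ℕ} (ψ : 𝓢(E n, ℂ)) (x y : E n) :
    reflectAt ψ x y = ψ (x - y) := by
  change ψ (-(y - x)) = _
  rw [neg_sub]

/-- The convolution `ψ ∗ u` of a Schwartz function and a tempered distribution, which is the
function `x ↦ ⟨u, ψ(x - ·)⟩`. -/
def conv {n : ℕ} (ψ : 𝓢(E n, ℂ)) (u : 𝓢'(E n, ℂ)) (x : E n) : ℂ :=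
  u (reflectAt ψ x)

/-- The Fourier multiplier `𝓕⁻¹ m 𝓕 u` with a Schwartz symbol `m`. It is the function
`(𝓕⁻¹ m) ∗ u`, that is, `x ↦ ⟨𝓕 u, m exp(2 π i ⟨x, ·⟩)⟩`. -/
def multiplier {n : ℕ} (m : 𝓢(E n, ℂ)) (u : 𝓢'(E n, ℂ)) : E n → ℂ :=
  conv (𝓕⁻ m) u

/-- The tempered distribution `u` is given by the locally integrable function `g`. -/
def Represents {n : ℕ} (g : E n → ℂ) (u : 𝓢'(E n, ℂ)) : Prop :=
  LocallyIntegrable g volume ∧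
    ∀ χ : 𝓢(E n, ℂ), HasCompactSupport χ → u χ = ∫ x, g x * χ x

/-! ### Local Hardy spaces -/

/-- `ψ_t(x) = t⁻ⁿ ψ(x / t)`, for `t > 0`. -/
def approxId {n : ℕ} (ψ : 𝓢(E n, ℂ)) (t : ℝ) (ht : 0 < t) : 𝓢(E n, ℂ) :=
  (((t ^ n)⁻¹ : ℝ) : ℂ) • scale t⁻¹ (inv_ne_zero ht.ne') ψ

/-- `‖u‖_{h^p} = ‖ sup_{0 < t < 1} |ψ_t ∗ u| ‖_{L^p}`; it is finite exactly on `h^p`. -/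
def localHardyNorm {n : ℕ} (ψ : 𝓢(E n, ℂ)) (p : ℝ) (u : 𝓢'(E n, ℂ)) : ℝ≥0∞ :=
  eLpNorm (fun x => ⨆ t : Set.Ioo (0 : ℝ) 1, ‖conv (approxId ψ t t.2.1) u x‖ₑ)
    (ENNReal.ofReal p) volume

/-! ### Besov and Triebel–Lizorkin spaces -/

/-- A smooth function supported in `{|ξ| < 3/2}` that equals `1` on `{|ξ| ≤ 4/3}`. -/
structure DyadicCutoff (n : ℕ) where
  toFun : E n → ℝ
  smooth : ContDiff ℝ ∞ toFun
  support_subset : Function.support toFun ⊆ Metric.ball 0 (3 / 2)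
  eq_one : ∀ ξ : E n, ‖ξ‖ ≤ 4 / 3 → toFun ξ = 1

/-- The cutoff as a (complex valued) Schwartz function. -/
def DyadicCutoff.toSchwartz {n : ℕ} (φ : DyadicCutoff n) : 𝓢(E n, ℂ) :=
  HasCompactSupport.toSchwartzMap (f := fun ξ => (φ.toFun ξ : ℂ))
    (HasCompactSupport.of_support_subset_isCompact (isCompact_closedBall (0 : E n) (3 / 2)) (by
      intro ξ hξ
      refine Metric.ball_subset_closedBall (φ.support_subset ?_)
      simpa using hξ))
    (Complex.ofRealCLM.contDiff.comp φ.smooth)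

/-- The dyadic decomposition: `φ₀ = φ` and `φ_j(ξ) = φ(2⁻ʲ ξ) - φ(2 · 2⁻ʲ ξ)` for `j ≥ 1`. -/
def DyadicCutoff.piece {n : ℕ} (φ : DyadicCutoff n) (j : ℕ) : 𝓢(E n, ℂ) :=
  if j = 0 then φ.toSchwartz
  else scale ((2 : ℝ) ^ j)⁻¹ (by positivity) φ.toSchwartz -
    scale (2 * ((2 : ℝ) ^ j)⁻¹) (by positivity) φ.toSchwartz

/-- The Littlewood–Paley operator `Δ_j = 𝓕⁻¹ φ_j 𝓕`. -/
def DyadicCutoff.block {n : ℕ} (φ : DyadicCutoff n) (j : ℕ) (u : 𝓢'(E n, ℂ)) : E n → ℂ :=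
  multiplier (φ.piece j) u

/-- `‖u‖_{B^{p,q}} = (∑_j ‖Δ_j u‖_{L^p}^q)^{1/q}` for `0 < p, q < ∞`. -/
def besovNorm {n : ℕ} (φ : DyadicCutoff n) (p q : ℝ) (u : 𝓢'(E n, ℂ)) : ℝ≥0∞ :=
  (∑' j : ℕ, eLpNorm (φ.block j u) (ENNReal.ofReal p) volume ^ q) ^ (1 / q)

/-- `‖u‖_{F^{p,q}} = ‖ (∑_j |Δ_j u|^q)^{1/q} ‖_{L^p}` for `0 < p, q < ∞`. -/
def triebelLizorkinNorm {n : ℕ} (φ : DyadicCutoff n) (p q : ℝ) (u : 𝓢'(E n, ℂ)) : ℝ≥0∞ :=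
  eLpNorm (fun x => (∑' j : ℕ, ‖φ.block j u x‖ₑ ^ q) ^ (1 / q)) (ENNReal.ofReal p) volume

/-! ### Modulation spaces -/

/-- A point of `ℤⁿ` as a point of `ℝⁿ`. -/
def latticePoint {n : ℕ} (k : Fin n → ℤ) : E n :=
  WithLp.toLp 2 (fun i => (k i : ℝ))

/-- A smooth function `ℝⁿ → [0,1]` with value `1` where `|ξ|_∞ ≤ 1/2` and `0` where
`|ξ|_∞ ≥ 3/4`. -/
structure UniformCutoff (n : ℕ) where
  toFun : E n → ℝ
  smooth : ContDiff ℝ ∞ toFun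
  mem_Icc : ∀ ξ, toFun ξ ∈ Set.Icc (0 : ℝ) 1
  eq_one : ∀ ξ : E n, (∀ i, |ξ i| ≤ 1 / 2) → toFun ξ = 1
  eq_zero : ∀ ξ : E n, (∃ i, 3 / 4 ≤ |ξ i|) → toFun ξ = 0

namespace UniformCutoff

variable {n : ℕ} (η : UniformCutoff n)

/-- `∑_{l ∈ ℤⁿ} η(ξ - l)`; the sum is locally finite. -/
def total (ξ : E n) : ℝ := ∑' l : Fin n → ℤ, η.toFun (ξ - latticePoint l)

/-- `σ(ξ) = η(ξ) / ∑_l η(ξ - l)`. -/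
def window (ξ : E n) : ℝ := η.toFun ξ / η.total ξ

/-- A finite set of lattice points that carries the sum for all points near `ξ₀`. -/
def nearby (ξ₀ : E n) : Finset (Fin n → ℤ) :=
  Fintype.piFinset fun i => Finset.Icc ⌊ξ₀ i - 2⌋ ⌈ξ₀ i + 2⌉

theorem eq_zero_of_notMem_nearby {ξ₀ ξ : E n} (h : ξ ∈ Metric.ball ξ₀ 1) {l : Fin n → ℤ}
    (hl : l ∉ nearby ξ₀) : η.toFun (ξ - latticePoint l) = 0 := by
  apply η.eq_zero
  by_contra! hcon
  apply hl
  simp only [nearby, Fintype.mem_piFinset, Finset.mem_Icc]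
  intro i
  have h1 : |ξ i - l i| < 3 / 4 := by simpa [latticePoint] using hcon i
  have h2 : |ξ i - ξ₀ i| < 1 := by
    have := PiLp.norm_apply_le (ξ - ξ₀) i
    have h3 : ‖ξ - ξ₀‖ < 1 := by simpa [dist_eq_norm] using h
    simp only [PiLp.sub_apply, Real.norm_eq_abs] at this
    linarith
  rw [abs_lt] at h1 h2
  constructor
  · have := Int.floor_le (ξ₀ i - 2)
    have h4 : ((⌊ξ₀ i - 2⌋ : ℤ) : ℝ) ≤ (l i : ℝ) := by linarith
    exact_mod_cast h4
  · have := Int.le_ceil (ξ₀ i + 2)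
    have h4 : (l i : ℝ) ≤ ((⌈ξ₀ i + 2⌉ : ℤ) : ℝ) := by linarith
    exact_mod_cast h4

theorem total_eq_sum {ξ₀ ξ : E n} (h : ξ ∈ Metric.ball ξ₀ 1) :
    η.total ξ = ∑ l ∈ nearby ξ₀, η.toFun (ξ - latticePoint l) :=
  tsum_eq_sum fun _ hl => η.eq_zero_of_notMem_nearby h hl

theorem contDiff_total : ContDiff ℝ ∞ η.total := by
  rw [contDiff_iff_contDiffAt]
  intro ξ₀
  have h : ContDiff ℝ ∞ fun ξ => ∑ l ∈ nearby ξ₀, η.toFun (ξ - latticePoint l) :=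
    ContDiff.sum fun l _ => η.smooth.comp (contDiff_id.sub contDiff_const)
  refine h.contDiffAt.congr_of_eventuallyEq ?_
  filter_upwards [Metric.ball_mem_nhds ξ₀ one_pos] with ξ hξ
  exact η.total_eq_sum hξ

theorem one_le_total (ξ : E n) : 1 ≤ η.total ξ := by
  let k : Fin n → ℤ := fun i => round (ξ i)
  have hk : η.toFun (ξ - latticePoint k) = 1 := by
    apply η.eq_one
    intro i
    simpa [latticePoint, k] using abs_sub_round (ξ i)
  have hmem : k ∈ nearby ξ := by
    by_contra hcon
    have := η.eq_zero_of_notMem_nearby (Metric.mem_ball_self one_pos) hcon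
    linarith
  rw [η.total_eq_sum (Metric.mem_ball_self one_pos), ← hk]
  exact Finset.single_le_sum (f := fun l => η.toFun (ξ - latticePoint l))
    (fun l _ => (η.mem_Icc _).1) hmem

theorem contDiff_window : ContDiff ℝ ∞ η.window :=
  η.smooth.div η.contDiff_total fun ξ => by
    have := η.one_le_total ξ
    linarith

theorem hasCompactSupport_window : HasCompactSupport η.window := by
  have hK : IsCompact
      ((EuclideanSpace.equiv (Fin n) ℝ).symm '' Set.Icc (fun _ => (-1 : ℝ)) (fun _ => 1)) :=
    isCompact_Icc.image (EuclideanSpace.equiv (Fin n) ℝ).symm.continuous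
  refine HasCompactSupport.of_support_subset_isCompact hK ?_
  intro ξ hξ
  have h0 : η.toFun ξ ≠ 0 := fun h => hξ (by simp [window, h])
  have hb : ∀ i, |ξ i| < 3 / 4 := by
    by_contra! hcon
    exact h0 (η.eq_zero ξ hcon)
  refine ⟨EuclideanSpace.equiv (Fin n) ℝ ξ, ⟨fun i => ?_, fun i => ?_⟩, by simp⟩
  · have := (abs_lt.mp (hb i)).1
    change (-1 : ℝ) ≤ ξ i
    linarith
  · have := (abs_lt.mp (hb i)).2
    change ξ i ≤ (1 : ℝ)
    linarith

/-- `σ` as a (complex valued) Schwartz function. -/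
def windowSchwartz : 𝓢(E n, ℂ) :=
  HasCompactSupport.toSchwartzMap (f := fun ξ => (η.window ξ : ℂ))
    (η.hasCompactSupport_window.comp_left (g := fun r : ℝ => (r : ℂ)) Complex.ofReal_zero)
    (Complex.ofRealCLM.contDiff.comp η.contDiff_window)

/-- The uniform decomposition `σ_k(ξ) = σ(ξ - k)`, `k ∈ ℤⁿ`. -/
def piece (k : Fin n → ℤ) : 𝓢(E n, ℂ) :=
  compSubConstCLM ℂ (latticePoint k) η.windowSchwartz

/-- The frequency-uniform decomposition operator `□_k = 𝓕⁻¹ σ_k 𝓕`. -/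
def block (k : Fin n → ℤ) (u : 𝓢'(E n, ℂ)) : E n → ℂ :=
  multiplier (η.piece k) u

end UniformCutoff

/-- `‖u‖_{M^{p,q}} = (∑_k ‖□_k u‖_{L^p}^q)^{1/q}` for `0 < p, q < ∞`. -/
def modulationNorm {n : ℕ} (η : UniformCutoff n) (p q : ℝ) (u : 𝓢'(E n, ℂ)) : ℝ≥0∞ :=
  (∑' k : Fin n → ℤ, eLpNorm (η.block k u) (ENNReal.ofReal p) volume ^ q) ^ (1 / q)

/-! ### Boundedness -/

/-- `H_Φ`, considered on the functions in `𝒟`, is bounded on `L^p`. -/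
def BoundedOnLp {n : ℕ} (p : ℝ) (Φ : E n → ℂ) (𝒟 : Set (E n → ℂ)) : Prop :=
  ∃ C : ℝ≥0, ∀ f ∈ 𝒟, MemLp f (ENNReal.ofReal p) volume →
    MemLp (hausdorff Φ f) (ENNReal.ofReal p) volume ∧
      eLpNorm (hausdorff Φ f) (ENNReal.ofReal p) volume ≤
        C * eLpNorm f (ENNReal.ofReal p) volume

/-- `H_Φ`, considered on the functions in `𝒟`, is bounded on the space
`X = {u ∈ 𝓢' : N u < ∞}` with quasi-norm `N`: if `f ∈ 𝒟` belongs to `X`, then so does `H_Φ f`,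
with `‖H_Φ f‖_X ≤ C ‖f‖_X`. Functions are identified with the distributions they represent. -/
def BoundedOn {n : ℕ} (N : 𝓢'(E n, ℂ) → ℝ≥0∞) (Φ : E n → ℂ) (𝒟 : Set (E n → ℂ)) : Prop :=
  ∃ C : ℝ≥0, ∀ f ∈ 𝒟, ∀ u : 𝓢'(E n, ℂ), Represents f u → N u < ⊤ →
    ∃ v : 𝓢'(E n, ℂ), Represents (hausdorff Φ f) v ∧ N v < ⊤ ∧ N v ≤ C * N u

end Hausdorff

end

/-!
In polar coordinates `H_Φ f (x) = ∫ g(r) f(x / r) dr`, where `g` is the density of the image of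
`Φ(y) dy` under `y ↦ |y|`, so that `H_Φ = 0` as soon as `g = 0` almost everywhere. Let `b` be a
bump function at the origin, `e` a unit vector and `b_N = b(· - N e)`. At the point `N s e + w` with
`w ⟂ e` and `|w| ≤ s / 2`, the integrand `g(r) b_N((N s e + w) / r)` lives on `|r - s| ≤ 4 s / N`,
hence `N (H_Φ b_N)(N s e + w)` has the size of `g(s)` for large `N` if `s` is a Lebesgue point.
The functions `b_N` all have the same quasi-norm, and compressing by `N` in the direction `e`
divides the `L^p` quasi-norm by `N^{1/p}`. So if `H_Φ` is bounded, then the functions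
`s e + w ↦ N (H_Φ b_N)(N s e + w)` have `L^p` quasi-norm `O(N^{1 - 1/p})`, which tends to `0`
because `p < 1`, and `g` must vanish.

The spaces other than `L^p` reduce to this: their quasi-norms are translation invariant, finite on
Schwartz functions, and dominate the `L^p` quasi-norm of a function that is continuous almost
everywhere, since such a function is recovered as a limit of its mollifications, or of its
frequency-localized partial sums, and `(∑ |a_j|)^p ≤ ∑ |a_j|^p`.
-/

noncomputable section

namespace Hausdorff

open Set Filter Topology
open scoped LineDeriv

/-! ### Polar coordinates -/

section Polar

variable {V F : Type*} [NormedAddCommGroup V] [NormedAddCommGroup F]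

theorem isCompact_norm_preimage_Icc [ProperSpace V] (a b : ℝ) :
    IsCompact ((‖·‖) ⁻¹' Icc a b : Set V) :=
  (isCompact_closedBall (0 : V) b).of_isClosed_subset (isClosed_Icc.preimage continuous_norm)
    fun y hy => by simpa using hy.2

theorem integrableOn_norm_preimage_Icc [ProperSpace V] [MeasurableSpace V]
    [OpensMeasurableSpace V] {μ : Measure V}
    {g : V → F} (hg : LocallyIntegrableOn g {0}ᶜ μ) {a : ℝ} (ha : 0 < a) (b : ℝ) :
    IntegrableOn g ((‖·‖) ⁻¹' Icc a b) μ := by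
  refine (hg.mono_set ?_).integrableOn_isCompact (isCompact_norm_preimage_Icc a b)
  rintro y hy rfl
  exact ha.not_ge (by simpa using hy.1)

theorem aestronglyMeasurable_of_continuousOn_compl_zero [SecondCountableTopology V]
    [MeasurableSpace V] [OpensMeasurableSpace V] {μ : Measure V} [NullSingletonClass μ] {g : V → F}
    (hg : ContinuousOn g {0}ᶜ) : AEStronglyMeasurable g μ := by
  rw [← restrict_compl_singleton (μ := μ) 0]
  exact hg.aestronglyMeasurable isOpen_compl_singleton.measurableSet

variable [NormedSpace ℝ V]

theorem smul_homeomorphUnitSphereProd (y : ({0}ᶜ : Set V)) :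
    ((homeomorphUnitSphereProd V y).2 : ℝ) • ((homeomorphUnitSphereProd V y).1 : V) = y :=
  congrArg Subtype.val ((homeomorphUnitSphereProd V).symm_apply_apply y)

theorem integrable_sphere_prod_volumeIoiPow [MeasurableSpace V] [BorelSpace V]
    [FiniteDimensional ℝ V] {μ : Measure V} [μ.IsAddHaarMeasure] {g : V → F}
    (hg : Integrable g μ) :
    Integrable (fun q : Metric.sphere (0 : V) 1 × Ioi (0 : ℝ) => g ((q.2 : ℝ) • (q.1 : V)))
      (μ.toSphere.prod (.volumeIoiPow (Module.finrank ℝ V - 1))) := by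
  rw [← μ.measurePreserving_homeomorphUnitSphereProd.integrable_comp_emb
    (homeomorphUnitSphereProd V).measurableEmbedding]
  exact ((integrableOn_iff_comap_subtypeVal (measurableSet_singleton (0 : V)).compl).1
    hg.integrableOn).congr (.of_forall fun y => congrArg g (smul_homeomorphUnitSphereProd y).symm)

variable [MeasurableSpace V] [NormedSpace ℝ F]

/-- The density `r^{d-1} ∫_{S^{d-1}} g(r ζ) dζ` with respect to `dr` of the image of `g dμ` under
`y ↦ ‖y‖`, where `d = dim V`. -/
def radialDensity (μ : Measure V) (g : V → F) (r : ℝ) : F :=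
  r ^ (Module.finrank ℝ V - 1) • ∫ ζ : Metric.sphere (0 : V) 1, g (r • (ζ : V)) ∂μ.toSphere

theorem radialDensity_mul_norm {𝕜 : Type*} [RCLike 𝕜] (μ : Measure V) (g : V → 𝕜) (h : ℝ → 𝕜)
    {r : ℝ} (hr : 0 ≤ r) :
    radialDensity μ (fun y => g y * h ‖y‖) r = radialDensity μ g r * h r := by
  simp only [radialDensity, norm_smul, norm_eq_of_mem_sphere, mul_one, Real.norm_of_nonneg hr,
    integral_mul_const, smul_mul_assoc]

variable [BorelSpace V] [FiniteDimensional ℝ V] {μ : Measure V} [μ.IsAddHaarMeasure]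

theorem integral_sphere_prod_volumeIoiPow [Nontrivial V] (g : V → F) :
    ∫ q : Metric.sphere (0 : V) 1 × Ioi (0 : ℝ), g ((q.2 : ℝ) • (q.1 : V))
      ∂(μ.toSphere.prod (.volumeIoiPow (Module.finrank ℝ V - 1))) = ∫ y, g y ∂μ := by
  rw [← μ.measurePreserving_homeomorphUnitSphereProd.integral_comp
    (homeomorphUnitSphereProd V).measurableEmbedding]
  simp only [smul_homeomorphUnitSphereProd]
  rw [integral_subtype_comap (measurableSet_singleton (0 : V)).compl g, restrict_compl_singleton]

theorem integrableOn_radialDensity {g : V → F} (hg : Integrable g μ) :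
    IntegrableOn (radialDensity μ g) (Ioi 0) := by
  have hprod := (integrable_sphere_prod_volumeIoiPow hg).integral_prod_right
  rw [Measure.volumeIoiPow, integrable_withDensity_iff_integrable_smul' (by fun_prop) (by simp)]
    at hprod
  refine (integrableOn_iff_comap_subtypeVal measurableSet_Ioi).2 (hprod.congr (.of_forall ?_))
  rintro ⟨r, hr : 0 < r⟩
  simp [radialDensity, ENNReal.toReal_ofReal (pow_nonneg hr.le _)]

theorem integral_radialDensity [Nontrivial V] {g : V → F} (hg : Integrable g μ) :
    ∫ r in Ioi (0 : ℝ), radialDensity μ g r = ∫ y, g y ∂μ := by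
  rw [← integral_sphere_prod_volumeIoiPow g,
    integral_prod_symm _ (integrable_sphere_prod_volumeIoiPow hg)]
  simp only [Measure.volumeIoiPow, ENNReal.ofReal]
  rw [integral_withDensity_eq_integral_smul (by fun_prop),
    ← integral_subtype_comap measurableSet_Ioi]
  refine integral_congr_ae (.of_forall ?_)
  rintro ⟨r, hr : 0 < r⟩
  simp [radialDensity, NNReal.smul_def, Real.coe_toNNReal _ (pow_nonneg hr.le _)]

theorem locallyIntegrableOn_radialDensity {𝕜 : Type*} [RCLike 𝕜] {g : V → 𝕜}
    (hg : LocallyIntegrableOn g {0}ᶜ μ) : LocallyIntegrableOn (radialDensity μ g) (Ioi 0) := by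
  refine (locallyIntegrableOn_iff isOpen_Ioi.isLocallyClosed).2 fun k hk hkc => ?_
  obtain rfl | hne := k.eq_empty_or_nonempty
  · exact integrableOn_empty
  obtain ⟨a, hak, ha⟩ := hkc.exists_isLeast hne
  obtain ⟨b, -, hb⟩ := hkc.exists_isGreatest hne
  have hcut : Integrable (fun y => g y * (Icc a b).indicator (fun _ => (1 : 𝕜)) ‖y‖) μ := by
    refine ((integrable_indicator_iff (measurableSet_Icc.preimage measurable_norm)).2
      (integrableOn_norm_preimage_Icc hg (hk hak) b)).congr (.of_forall fun y => ?_)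
    by_cases hy : ‖y‖ ∈ Icc a b <;> simp [indicator, hy]
  refine ((integrableOn_radialDensity hcut).mono_set hk).congr_fun (fun r hr => ?_)
    hkc.measurableSet
  rw [radialDensity_mul_norm μ g _ (le_of_lt (hk hr)),
    indicator_of_mem (mem_Icc.2 ⟨ha hr, hb hr⟩), mul_one]

end Polar

theorem hausdorff_eq_integral_radialDensity {n : ℕ} [Nontrivial (E n)] {Φ f : E n → ℂ} {x : E n}
    (hi : Integrable fun y => Φ y * f (‖y‖⁻¹ • x)) :
    hausdorff Φ f x = ∫ r in Ioi (0 : ℝ), radialDensity volume Φ r * f (r⁻¹ • x) := by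
  rw [hausdorff, ← integral_radialDensity hi]
  exact setIntegral_congr_fun measurableSet_Ioi fun r hr =>
    radialDensity_mul_norm volume Φ (fun r => f (r⁻¹ • x)) (le_of_lt hr)

theorem isZeroOperator_of_radialDensity_ae_zero {n : ℕ} [Nontrivial (E n)] {Φ : E n → ℂ}
    (h0 : ∀ᵐ r ∂volume.restrict (Ioi (0 : ℝ)), radialDensity volume Φ r = 0) :
    IsZeroOperator Φ := by
  rintro f ⟨-, hf⟩
  filter_upwards [hf] with x hx
  rw [hausdorff_eq_integral_radialDensity hx]
  refine integral_eq_zero_of_ae ?_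
  filter_upwards [h0] with r hr
  simp [hr]

/-! ### The operator on test functions -/

section TestFunctions

variable {n : ℕ} {Φ f : E n → ℂ}

theorem exists_norm_mem_Icc_of_mem_testFunctions (hf : f ∈ testFunctions n) :
    ∃ a b : ℝ, 0 < a ∧ 0 < b ∧ ∀ z, f z ≠ 0 → ‖z‖ ∈ Icc a b := by
  obtain ⟨-, hcs, h0⟩ := hf
  obtain ⟨b, hb⟩ := hcs.isBounded.exists_norm_le
  obtain ⟨a, ha, hball⟩ := Metric.mem_nhds_iff.1 ((isClosed_tsupport f).isOpen_compl.mem_nhds h0)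
  refine ⟨a, max b 1, ha, by positivity, fun z hz => ?_⟩
  have hzf : z ∈ tsupport f := subset_tsupport f hz
  refine ⟨?_, (hb z hzf).trans (le_max_left b 1)⟩
  by_contra! hlt
  exact hball (by simpa using hlt) hzf

theorem exists_norm_mem_Icc_of_apply_ne_zero (hf : f ∈ testFunctions n) {c : ℝ} (hc : 0 < c)
    (d : ℝ) : ∃ a b : ℝ, 0 < a ∧ ∀ x : E n, ‖x‖ ∈ Icc c d → ∀ y : E n, f (‖y‖⁻¹ • x) ≠ 0 →
      ‖y‖ ∈ Icc a b := by
  obtain ⟨a, b, ha, hb, hab⟩ := exists_norm_mem_Icc_of_mem_testFunctions hf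
  refine ⟨c / b, d / a, by positivity, fun x hx y hy => ?_⟩
  have hquot := hab _ hy
  rw [norm_smul, norm_inv, norm_norm, inv_mul_eq_div] at hquot
  have hy0 : 0 < ‖y‖ := by
    refine (norm_nonneg y).lt_of_ne fun h => ?_
    rw [← h, div_zero] at hquot
    exact ha.not_ge hquot.1
  obtain ⟨hlow, hupp⟩ := hquot
  rw [le_div_iff₀ hy0] at hlow
  rw [div_le_iff₀ hy0] at hupp
  constructor
  · rw [div_le_iff₀ hb]
    linarith [hx.1]
  · rw [le_div_iff₀ ha]
    linarith [hx.2]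

theorem exists_integrable_bound (hΦ : LocallyIntegrableOn Φ {0}ᶜ volume)
    (hf : f ∈ testFunctions n) {c : ℝ} (hc : 0 < c) (d : ℝ) :
    ∃ B : E n → ℝ, Integrable B ∧ ∀ x : E n, ‖x‖ ∈ Icc c d → ∀ y,
      ‖Φ y * f (‖y‖⁻¹ • x)‖ ≤ B y := by
  obtain ⟨A, hA⟩ := hf.2.1.exists_bound_of_continuous hf.1.continuous
  obtain ⟨a, b, ha, hab⟩ := exists_norm_mem_Icc_of_apply_ne_zero hf hc d
  refine ⟨((‖·‖) ⁻¹' Icc a b).indicator fun y => ‖Φ y‖ * A,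
    (integrable_indicator_iff (measurableSet_Icc.preimage measurable_norm)).2
      ((integrableOn_norm_preimage_Icc hΦ ha b).norm.mul_const A), fun x hx y => ?_⟩
  by_cases hy : f (‖y‖⁻¹ • x) = 0
  · have hA0 : 0 ≤ A := (norm_nonneg _).trans (hA 0)
    simpa [hy] using indicator_nonneg (fun y _ => mul_nonneg (norm_nonneg (Φ y)) hA0) y
  · rw [indicator_of_mem (mem_preimage.2 (hab x hx y hy)), norm_mul]
    gcongr
    exact hA _

variable [Nontrivial (E n)]

theorem aestronglyMeasurable_integrand (hΦ : LocallyIntegrableOn Φ {0}ᶜ volume)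
    (hf : f ∈ testFunctions n) (x : E n) :
    AEStronglyMeasurable (fun y => Φ y * f (‖y‖⁻¹ • x)) volume := by
  have hΦm : AEStronglyMeasurable Φ volume := by
    simpa only [restrict_compl_singleton] using hΦ.aestronglyMeasurable
  have hsmul : Measurable fun y : E n => ‖y‖⁻¹ • x := by fun_prop
  exact hΦm.mul (hf.1.continuous.measurable.comp hsmul).aestronglyMeasurable

theorem integrable_integrand (hΦ : LocallyIntegrableOn Φ {0}ᶜ volume) (hf : f ∈ testFunctions n)
    {x : E n} (hx : x ≠ 0) : Integrable fun y => Φ y * f (‖y‖⁻¹ • x) := by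
  obtain ⟨B, hB, hle⟩ := exists_integrable_bound hΦ hf (norm_pos_iff.2 hx) ‖x‖
  exact hB.mono' (aestronglyMeasurable_integrand hΦ hf x)
    (.of_forall (hle x (right_mem_Icc.2 le_rfl)))

theorem continuousOn_hausdorff (hΦ : LocallyIntegrableOn Φ {0}ᶜ volume)
    (hf : f ∈ testFunctions n) : ContinuousOn (hausdorff Φ f) {0}ᶜ := by
  refine fun x hx => ContinuousAt.continuousWithinAt ?_
  have hx0 : 0 < ‖x‖ := norm_pos_iff.2 hx
  obtain ⟨B, hB, hle⟩ := exists_integrable_bound hΦ hf (half_pos hx0) (2 * ‖x‖)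
  have hnear : ∀ᶠ z in 𝓝 x, ‖z‖ ∈ Icc (‖x‖ / 2) (2 * ‖x‖) :=
    continuous_norm.continuousAt.eventually_mem (Icc_mem_nhds (by linarith) (by linarith))
  refine continuousAt_of_dominated (.of_forall (aestronglyMeasurable_integrand hΦ hf))
    (hnear.mono fun z hz => .of_forall (hle z hz)) hB (.of_forall fun y => ?_)
  have := hf.1.continuous
  fun_prop

end TestFunctions

/-! ### Concentration of translated bumps along a ray -/

section LebesguePoint

variable {α F : Type*} [MeasurableSpace α] [NormedAddCommGroup F]

theorem ae_tendsto_average_norm_sub_of_locallyIntegrableOn [MetricSpace α]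
    [SecondCountableTopology α] [BorelSpace α] {μ : Measure α} [IsLocallyFiniteMeasure μ]
    [IsUnifLocDoublingMeasure μ] {g : α → F} {U : Set α} (hU : IsOpen U)
    (hg : LocallyIntegrableOn g U μ) :
    ∀ᵐ x ∂μ.restrict U,
      Tendsto (fun r => ⨍ y in Metric.closedBall x r, ‖g y - g x‖ ∂μ) (𝓝[>] 0) (𝓝 0) := by
  obtain ⟨u, huo, hu, hgu⟩ := hg.exists_nat_integrableOn
  have hmeas : ∀ k, MeasurableSet (u k ∩ U) := fun k => ((huo k).inter hU).measurableSet
  have hpiece : ∀ᵐ x ∂μ, ∀ k, Tendsto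
      (fun r => ⨍ y in Metric.closedBall x r,
        ‖(u k ∩ U).indicator g y - (u k ∩ U).indicator g x‖ ∂μ) (𝓝[>] 0) (𝓝 0) := by
    refine ae_all_iff.2 fun k => ?_
    have hk := IsUnifLocDoublingMeasure.ae_tendsto_average_norm_sub μ
      ((integrable_indicator_iff (hmeas k)).2 (hgu k)).locallyIntegrable 1
    filter_upwards [hk] with x hx
    refine hx (fun _ => x) id tendsto_id (eventually_mem_nhdsWithin.mono fun r hr => ?_)
    exact Metric.mem_closedBall_self (by simpa using le_of_lt hr)
  rw [ae_restrict_iff' hU.measurableSet]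
  filter_upwards [hpiece] with x hx hxU
  obtain ⟨k, hk⟩ := mem_iUnion.1 (hu hxU)
  obtain ⟨ε, hε, hball⟩ :=
    Metric.nhds_basis_closedBall.mem_iff.1 (((huo k).inter hU).mem_nhds ⟨hk, hxU⟩)
  refine (hx k).congr' ?_
  filter_upwards [Ioc_mem_nhdsGT hε] with r hr
  refine setAverage_congr_fun Metric.isClosed_closedBall.measurableSet (.of_forall fun y hy => ?_)
  rw [indicator_of_mem (hball (Metric.closedBall_subset_closedBall hr.2 hy)),
    indicator_of_mem (show x ∈ u k ∩ U from ⟨hk, hxU⟩)]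

variable [NormedSpace ℝ F] [CompleteSpace F]

theorem norm_integral_smul_le_average {μ : Measure α} {S : Set α} (hμS : μ S ≠ ⊤)
    {K : α → ℝ} {M : ℝ} (hKi : Integrable K μ) (hKS : ∀ y ∉ S, K y = 0)
    (hKM : ∀ y, ‖K y‖ ≤ M / μ.real S) {g : α → F} (hg : IntegrableOn g S μ) (c : F) :
    ‖(∫ y, K y ∂μ) • c‖ ≤ ‖∫ y, K y • g y ∂μ‖ + M * ⨍ y in S, ‖g y - c‖ ∂μ := by
  have hrestrict : ∀ h : α → F, ∫ y, K y • h y ∂μ = ∫ y in S, K y • h y ∂μ := fun h =>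
    (setIntegral_eq_integral_of_forall_compl_eq_zero fun y hy => by simp [hKS y hy]).symm
  have hgi : IntegrableOn (fun y => K y • g y) S μ :=
    Integrable.bdd_smul hg _ hKi.aestronglyMeasurable.restrict (.of_forall hKM)
  have hci : IntegrableOn (fun y => K y • c) S μ := (hKi.smul_const c).integrableOn
  have hsplit : (∫ y, K y ∂μ) • c =
      (∫ y, K y • g y ∂μ) - ∫ y in S, K y • (g y - c) ∂μ := by
    simp only [smul_sub, integral_sub hgi hci, ← hrestrict, integral_smul_const]
    abel
  have hdiff : ‖∫ y in S, K y • (g y - c) ∂μ‖ ≤ M * ⨍ y in S, ‖g y - c‖ ∂μ := by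
    rw [setAverage_eq, smul_eq_mul, ← mul_assoc, ← div_eq_mul_inv, ← integral_const_mul]
    refine norm_integral_le_of_norm_le
      ((hg.sub (integrableOn_const hμS)).norm.const_mul _) (.of_forall fun y => ?_)
    rw [norm_smul]
    exact mul_le_mul_of_nonneg_right (hKM y) (norm_nonneg _)
  rw [hsplit]
  exact (norm_sub_le _ _).trans (add_le_add_right hdiff _)

end LebesguePoint

section Slice

variable {V : Type*} [NormedAddCommGroup V] [NormedSpace ℝ V] [FiniteDimensional ℝ V]
  [MeasurableSpace V] [BorelSpace V]

theorem quasiMeasurePreserving_of_surjective {W : Type*} [NormedAddCommGroup W] [NormedSpace ℝ W]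
    [MeasurableSpace W] [BorelSpace W] (μ : Measure V) [μ.IsAddHaarMeasure] (ν : Measure W)
    [ν.IsAddHaarMeasure] {L : V →ₗ[ℝ] W} (hL : Function.Surjective L) :
    Measure.QuasiMeasurePreserving L μ ν := by
  obtain ⟨c, -, hc⟩ := L.exists_map_addHaar_eq_smul_addHaar μ ν hL
  exact ⟨L.continuous_of_finiteDimensional.measurable, hc ▸ Measure.smul_absolutelyContinuous⟩

theorem eLpNorm_comp_linearMap {μ : Measure V} [μ.IsAddHaarMeasure] {F : Type*}
    [NormedAddCommGroup F] {L : V →ₗ[ℝ] V} (hL : LinearMap.det L ≠ 0) {p : ℝ≥0∞} (hp : p ≠ ⊤)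
    {g : V → F} (hg : AEStronglyMeasurable g μ) :
    eLpNorm (g ∘ L) p μ =
      ENNReal.ofReal |(LinearMap.det L)⁻¹| ^ (1 / p).toReal * eLpNorm g p μ := by
  have hmap := Measure.map_linearMap_addHaar_eq_smul_addHaar μ hL
  rw [← eLpNorm_map_measure (hmap ▸ hg.smul_measure _)
    L.continuous_of_finiteDimensional.aemeasurable, hmap, eLpNorm_smul_measure_of_ne_top hp,
    smul_eq_mul]

end Slice

section InnerProductSpace

variable {V : Type*} [NormedAddCommGroup V] [InnerProductSpace ℝ V]

theorem ae_ae_smul_add_orthogonal [FiniteDimensional ℝ V] [MeasurableSpace V] [BorelSpace V]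
    (e : V) {P : V → Prop} (hP : ∀ᵐ x, P x) :
    ∀ᵐ t : ℝ, ∀ᵐ y : V, P (t • e + (y - inner ℝ e y • e)) := by
  let L : ℝ × V →ₗ[ℝ] V := (LinearMap.toSpanSingleton ℝ V e).coprod
    (.id - (innerₛₗ ℝ e).smulRight e)
  have hL : Function.Surjective L := fun z => ⟨(inner ℝ e z, z), by simp [L]⟩
  exact Measure.ae_ae_of_ae_prod
    ((quasiMeasurePreserving_of_surjective (volume.prod volume) volume hL).ae hP)

theorem exists_orthogonal_of_ae [FiniteDimensional ℝ V] [MeasurableSpace V] [BorelSpace V]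
    {e : V} (he : ‖e‖ = 1) {P : V → Prop} (hP : ∀ᵐ x, P x) :
    ∀ᵐ s : ℝ, 0 < s → ∃ w, inner ℝ e w = 0 ∧ ‖w‖ ≤ s / 2 ∧ P (s • e + w) := by
  filter_upwards [ae_ae_smul_add_orthogonal e hP] with s hs hs0
  obtain ⟨y, hy, hyP⟩ := (Measure.dense_of_ae hs).exists_mem_open Metric.isOpen_ball
    ⟨0, Metric.mem_ball_self (show 0 < s / 4 by positivity)⟩
  rw [mem_ball_zero_iff] at hyP
  refine ⟨y - inner ℝ e y • e, by simp [inner_sub_right, inner_smul_right, he], ?_, hy⟩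
  have hproj : ‖inner ℝ e y • e‖ ≤ ‖y‖ := by
    simpa only [norm_smul, he, mul_one, one_mul] using norm_inner_le_norm (𝕜 := ℝ) e y
  linarith [norm_sub_le y (inner ℝ e y • e)]

/-- The dilation of `V` by the factor `N` in the direction `e`. -/
def stretch (e : V) (N : ℝ) : V →ₗ[ℝ] V :=
  LinearMap.transvection ((N - 1) • innerₛₗ ℝ e) e

theorem stretch_smul_add {e w : V} (he : ‖e‖ = 1) (hw : inner ℝ e w = 0) (N t : ℝ) :
    stretch e N (t • e + w) = (N * t) • e + w := by
  simp only [stretch, LinearMap.transvection.apply, LinearMap.smul_apply, innerₛₗ_apply_apply,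
    inner_add_right, inner_smul_right, real_inner_self_eq_norm_sq, he, hw, smul_eq_mul]
  module

theorem det_stretch [FiniteDimensional ℝ V] {e : V} (he : ‖e‖ = 1) (N : ℝ) :
    LinearMap.det (stretch e N) = N := by
  simp [stretch, LinearMap.transvection.det, he]

theorem abs_sub_le_of_norm_smul_sub_lt {e w : V} (he : ‖e‖ = 1) (hw : inner ℝ e w = 0)
    {N s r : ℝ} (hN : 5 ≤ N) (hs : 0 < s) (hr : 0 < r)
    (h : ‖r⁻¹ • ((N * s) • e + w) - N • e‖ < 2) : |r - s| ≤ 4 * s / N := by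
  have hcoord : inner ℝ e (r⁻¹ • ((N * s) • e + w) - N • e) = N * (s - r) / r := by
    simp only [inner_sub_right, inner_add_right, inner_smul_right, real_inner_self_eq_norm_sq, he,
      hw]
    field_simp
    ring
  have hlt : |N * (s - r) / r| < 2 := by
    refine lt_of_le_of_lt ?_ h
    simpa only [hcoord, he, one_mul] using
      abs_real_inner_le_norm e (r⁻¹ • ((N * s) • e + w) - N • e)
  rw [abs_div, abs_of_pos hr, div_lt_iff₀ hr, abs_lt] at hlt
  rw [le_div_iff₀ (by linarith), ← abs_of_pos (show 0 < N by linarith), ← abs_mul, abs_le]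
  constructor <;> nlinarith

theorem norm_smul_sub_le_one {e w : V} (he : ‖e‖ = 1) {N s r : ℝ} (hN : 0 < N) (hs : 0 < s)
    (hw : ‖w‖ ≤ s / 2) (hr : r ∈ Icc s (s + s / (2 * N))) :
    ‖r⁻¹ • ((N * s) • e + w) - N • e‖ ≤ 1 := by
  have hr0 : 0 < r := hs.trans_le hr.1
  have hsplit : r⁻¹ • ((N * s) • e + w) - N • e = r⁻¹ • ((N * (s - r)) • e + w) := by
    have : N • e = r⁻¹ • (N * r) • e := by rw [smul_smul]; congr 1; field_simp
    rw [this, ← smul_sub]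
    congr 1
    module
  have hrad : N * (r - s) ≤ s / 2 := by
    have := mul_le_mul_of_nonneg_left (show r - s ≤ s / (2 * N) by linarith [hr.2]) hN.le
    rwa [show N * (s / (2 * N)) = s / 2 by field_simp] at this
  have hnorm : ‖(N * (s - r)) • e‖ = N * (r - s) := by
    rw [norm_smul, he, mul_one, Real.norm_eq_abs, abs_mul, abs_of_pos hN, abs_sub_comm,
      abs_of_nonneg (sub_nonneg.2 hr.1)]
  rw [hsplit, norm_smul, norm_inv, Real.norm_of_nonneg hr0.le, inv_mul_le_one₀ hr0]
  linarith [norm_add_le ((N * (s - r)) • e) w, hr.1]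

end InnerProductSpace

section RayKernel

variable {V : Type*} [NormedAddCommGroup V] [InnerProductSpace ℝ V] [FiniteDimensional ℝ V]

/-- A smooth bump function around the origin: it is `1` on the unit ball and vanishes outside the
ball of radius `2`. -/
def unitBump (V : Type*) [NormedAddCommGroup V] : ContDiffBump (0 : V) :=
  ⟨1, 2, one_pos, one_lt_two⟩

theorem unitBump_eq_one {z : V} (hz : ‖z‖ ≤ 1) : unitBump V z = 1 :=
  (unitBump V).one_of_mem_closedBall (by simpa [unitBump] using hz)

theorem unitBump_eq_zero {z : V} (hz : 2 ≤ ‖z‖) : unitBump V z = 0 :=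
  (unitBump V).zero_of_le_dist (by simpa [unitBump] using hz)

/-- The kernel against which `H_Φ`, applied to the bump at `N e` and evaluated at `N s e + w`,
integrates the radial density of `Φ`, normalised by the factor `N`. -/
def rayKernel (e w : V) (N s : ℝ) : ℝ → ℝ :=
  (Ioi 0).indicator fun r => N * unitBump V (r⁻¹ • ((N * s) • e + w) - N • e)

variable {e w : V} {N s : ℝ}

theorem rayKernel_nonneg (hN : 0 ≤ N) (r : ℝ) : 0 ≤ rayKernel e w N s r :=
  indicator_nonneg (fun _ _ => mul_nonneg hN (unitBump V).nonneg) r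

theorem rayKernel_le (hN : 0 ≤ N) (r : ℝ) : rayKernel e w N s r ≤ N :=
  indicator_apply_le' (fun _ => mul_le_of_le_one_right hN (unitBump V).le_one) fun _ => hN

theorem rayKernel_eq_zero (he : ‖e‖ = 1) (hw : inner ℝ e w = 0) (hN : 5 ≤ N) (hs : 0 < s) {r : ℝ}
    (hr : r ∉ Metric.closedBall s (4 * s / N)) : rayKernel e w N s r = 0 := by
  refine indicator_apply_eq_zero.2 fun hr0 => ?_
  rw [unitBump_eq_zero, mul_zero]
  contrapose! hr
  exact abs_sub_le_of_norm_smul_sub_lt he hw hN hs hr0 hr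

theorem rayKernel_eq (he : ‖e‖ = 1) (hws : ‖w‖ ≤ s / 2) (hN : 0 < N) (hs : 0 < s) {r : ℝ}
    (hr : r ∈ Icc s (s + s / (2 * N))) : rayKernel e w N s r = N := by
  rw [rayKernel, indicator_of_mem (mem_Ioi.2 (hs.trans_le hr.1)),
    unitBump_eq_one (norm_smul_sub_le_one he hN hs hws hr), mul_one]

theorem integrable_rayKernel (he : ‖e‖ = 1) (hw : inner ℝ e w = 0) (hN : 5 ≤ N) (hs : 0 < s) :
    Integrable (rayKernel e w N s) := by
  borelize V
  have hmeas : Measurable (rayKernel e w N s) := by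
    have hbump : Measurable (unitBump V) := (unitBump V).continuous.measurable
    exact (measurable_const.mul (hbump.comp (by fun_prop))).indicator measurableSet_Ioi
  have hball : IntegrableOn (fun _ => N) (Metric.closedBall s (4 * s / N)) :=
    integrableOn_const measure_closedBall_lt_top.ne
  refine ((integrable_indicator_iff measurableSet_closedBall).2 hball).mono'
    hmeas.aestronglyMeasurable (.of_forall fun r => ?_)
  rw [Real.norm_of_nonneg (rayKernel_nonneg (by linarith) r)]
  by_cases hr : r ∈ Metric.closedBall s (4 * s / N)
  · simpa only [indicator_of_mem hr] using rayKernel_le (by linarith) r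
  · simp only [indicator_of_notMem hr, rayKernel_eq_zero he hw hN hs hr, le_rfl]

theorem half_le_integral_rayKernel (he : ‖e‖ = 1) (hw : inner ℝ e w = 0) (hws : ‖w‖ ≤ s / 2)
    (hN : 5 ≤ N) (hs : 0 < s) : s / 2 ≤ ∫ r, rayKernel e w N s r := by
  have hN0 : 0 < N := by linarith
  calc s / 2 = ∫ _ in Icc s (s + s / (2 * N)), N := by
        rw [setIntegral_const, Real.volume_real_Icc_of_le
          (le_add_of_nonneg_right (by positivity)), smul_eq_mul]
        field_simp
        ring
    _ = ∫ r in Icc s (s + s / (2 * N)), rayKernel e w N s r :=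
        setIntegral_congr_fun measurableSet_Icc fun r hr => (rayKernel_eq he hws hN0 hs hr).symm
    _ ≤ ∫ r, rayKernel e w N s r :=
        setIntegral_le_integral (integrable_rayKernel he hw hN hs)
          (.of_forall (rayKernel_nonneg hN0.le))

theorem half_mul_norm_le {F : Type*} [NormedAddCommGroup F] [NormedSpace ℝ F] [CompleteSpace F]
    (he : ‖e‖ = 1) (hw : inner ℝ e w = 0) (hws : ‖w‖ ≤ s / 2) (hN : 5 ≤ N) (hs : 0 < s)
    {g : ℝ → F} (hg : LocallyIntegrableOn g (Ioi 0)) :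
    s / 2 * ‖g s‖ ≤ ‖∫ r, rayKernel e w N s r • g r‖ +
      8 * s * ⨍ r in Metric.closedBall s (4 * s / N), ‖g r - g s‖ := by
  have hN0 : 0 < N := by linarith
  have hball : Metric.closedBall s (4 * s / N) ⊆ Ioi 0 := fun r hr => by
    rw [Metric.mem_closedBall, Real.dist_eq, le_div_iff₀ hN0] at hr
    have := neg_abs_le (r - s)
    rw [mem_Ioi]
    nlinarith
  have hbound : ∀ r, ‖rayKernel e w N s r‖ ≤
      8 * s / volume.real (Metric.closedBall s (4 * s / N)) := fun r => by
    rw [Real.norm_of_nonneg (rayKernel_nonneg hN0.le r),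
      Real.volume_real_closedBall (by positivity)]
    refine (rayKernel_le hN0.le r).trans_eq ?_
    field_simp
    ring
  refine le_trans ?_ (norm_integral_smul_le_average measure_closedBall_lt_top.ne
    (integrable_rayKernel he hw hN hs) (fun r hr => rayKernel_eq_zero he hw hN hs hr) hbound
    ((hg.mono_set hball).integrableOn_isCompact (isCompact_closedBall _ _)) (g s))
  rw [norm_smul]
  gcongr
  exact (half_le_integral_rayKernel he hw hws hN hs).trans (le_abs_self _)

end RayKernel

section Concentration

variable {n : ℕ}

/-- The bump function `unitBump` as a Schwartz function. -/
def bumpSchwartz (n : ℕ) : 𝓢(E n, ℂ) :=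
  HasCompactSupport.toSchwartzMap (f := fun x => (unitBump (E n) x : ℂ))
    ((unitBump (E n)).hasCompactSupport.comp_left (g := Complex.ofReal) Complex.ofReal_zero)
    (Complex.ofRealCLM.contDiff.comp (unitBump (E n)).contDiff)

theorem hasCompactSupport_bumpSchwartz : HasCompactSupport (bumpSchwartz n) :=
  (unitBump (E n)).hasCompactSupport.comp_left (g := Complex.ofReal) Complex.ofReal_zero

theorem bumpSchwartz_eq_one {x : E n} (hx : ‖x‖ ≤ 1) : bumpSchwartz n x = 1 := by
  change ((unitBump (E n) x : ℝ) : ℂ) = 1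
  rw [unitBump_eq_one hx, Complex.ofReal_one]

theorem compSubConstCLM_bumpSchwartz_apply (a x : E n) :
    compSubConstCLM ℂ a (bumpSchwartz n) x = (unitBump (E n) (x - a) : ℂ) := rfl

theorem compSubConstCLM_bumpSchwartz_mem_testFunctions {a : E n} (ha : 2 < ‖a‖) :
    (compSubConstCLM ℂ a (bumpSchwartz n) : E n → ℂ) ∈ testFunctions n := by
  refine ⟨(compSubConstCLM ℂ a (bumpSchwartz n)).smooth ⊤, ?_, ?_⟩
  · exact hasCompactSupport_bumpSchwartz.comp_homeomorph (Homeomorph.subRight a)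
  · rw [notMem_tsupport_iff_eventuallyEq]
    have hc : ContinuousAt (fun x : E n => ‖x - a‖) 0 := by fun_prop
    filter_upwards [hc.eventually_const_lt (show 2 < ‖(0 : E n) - a‖ by simpa using ha)] with x hx
    rw [compSubConstCLM_bumpSchwartz_apply, unitBump_eq_zero hx.le]
    rfl

variable {Φ : E n → ℂ} {e : E n}

/-- The image under `H_Φ` of the bump at `N e`, stretched by the factor `N` in the direction `e`
and normalised by the factor `N`. -/
def stretchedImage (Φ : E n → ℂ) (e : E n) (N : ℕ) : E n → ℂ :=
  (N : ℂ) • (hausdorff Φ (compSubConstCLM ℂ ((N : ℝ) • e) (bumpSchwartz n)) ∘ stretch e N)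

theorem compSubConstCLM_bumpSchwartz_smul_mem_testFunctions (he : ‖e‖ = 1) {N : ℕ} (hN : 5 ≤ N) :
    (compSubConstCLM ℂ ((N : ℝ) • e) (bumpSchwartz n) : E n → ℂ) ∈ testFunctions n := by
  have : (5 : ℝ) ≤ N := by exact_mod_cast hN
  refine compSubConstCLM_bumpSchwartz_mem_testFunctions ?_
  rw [norm_smul, he, Real.norm_of_nonneg (by positivity)]
  linarith

variable [Nontrivial (E n)]

theorem stretchedImage_smul_add (hΦ : LocallyIntegrableOn Φ {0}ᶜ volume) (he : ‖e‖ = 1)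
    {w : E n} (hw : inner ℝ e w = 0) {s : ℝ} (hs : 0 < s) {N : ℕ} (hN : 5 ≤ N) :
    stretchedImage Φ e N (s • e + w) =
      ∫ r, rayKernel e w N s r • radialDensity volume Φ r := by
  have hN0 : (0 : ℝ) < N := by positivity
  have hpoint : ((N : ℝ) * s) • e + w ≠ 0 := fun h => by
    have := congrArg (inner ℝ e) h
    simp [inner_add_right, inner_smul_right, he, hw, hN0.ne', hs.ne'] at this
  simp only [stretchedImage, Pi.smul_apply, Function.comp_apply, stretch_smul_add he hw,
    hausdorff_eq_integral_radialDensity (integrable_integrand hΦ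
      (compSubConstCLM_bumpSchwartz_smul_mem_testFunctions he hN) hpoint)]
  rw [← integral_smul, ← integral_indicator measurableSet_Ioi]
  congr 1 with r
  by_cases hr : r ∈ Ioi (0 : ℝ)
  · simp only [indicator_of_mem hr, rayKernel, compSubConstCLM_bumpSchwartz_apply, smul_eq_mul,
      Complex.real_smul, Complex.ofReal_mul, Complex.ofReal_natCast]
    ring
  · simp [indicator_of_notMem hr, rayKernel]

theorem aestronglyMeasurable_hausdorff_bump (hΦ : LocallyIntegrableOn Φ {0}ᶜ volume)
    (he : ‖e‖ = 1) {N : ℕ} (hN : 5 ≤ N) : AEStronglyMeasurable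
      (hausdorff Φ (compSubConstCLM ℂ ((N : ℝ) • e) (bumpSchwartz n))) volume :=
  aestronglyMeasurable_of_continuousOn_compl_zero
    (continuousOn_hausdorff hΦ (compSubConstCLM_bumpSchwartz_smul_mem_testFunctions he hN))

theorem aestronglyMeasurable_stretchedImage (hΦ : LocallyIntegrableOn Φ {0}ᶜ volume)
    (he : ‖e‖ = 1) {N : ℕ} (hN : 5 ≤ N) :
    AEStronglyMeasurable (stretchedImage Φ e N) volume :=
  ((aestronglyMeasurable_hausdorff_bump hΦ he hN).comp_quasiMeasurePreserving
    (Measure.LinearMap.quasiMeasurePreserving _ _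
      (by rw [det_stretch he]; exact_mod_cast (by lia : N ≠ 0)))).const_smul _

theorem eLpNorm_stretchedImage (hΦ : LocallyIntegrableOn Φ {0}ᶜ volume) (he : ‖e‖ = 1)
    {p : ℝ≥0∞} (hp : p ≠ ⊤) {N : ℕ} (hN : 5 ≤ N) :
    eLpNorm (stretchedImage Φ e N) p volume = (N : ℝ≥0∞) ^ (1 - (1 / p).toReal) *
      eLpNorm (hausdorff Φ (compSubConstCLM ℂ ((N : ℝ) • e) (bumpSchwartz n))) p volume := by
  have hN0 : (N : ℝ) ≠ 0 := by exact_mod_cast (by lia : N ≠ 0)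
  rw [stretchedImage, eLpNorm_const_smul, eLpNorm_comp_linearMap (by rwa [det_stretch he]) hp
    (aestronglyMeasurable_hausdorff_bump hΦ he hN), det_stretch he, ← mul_assoc,
    sub_eq_add_neg, ENNReal.rpow_add _ _ (by exact_mod_cast hN0) (ENNReal.natCast_ne_top N),
    ENNReal.rpow_one, ENNReal.rpow_neg, ← ENNReal.inv_rpow, abs_of_nonneg (by positivity),
    ENNReal.ofReal_inv_of_pos (by positivity), ENNReal.ofReal_natCast]
  congr 2
  simp [enorm_eq_nnnorm]

theorem tendsto_eLpNorm_stretchedImage (hΦ : LocallyIntegrableOn Φ {0}ᶜ volume) (he : ‖e‖ = 1)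
    {p C : ℝ≥0∞} (hp0 : p ≠ 0) (hp1 : p < 1) (hC : C ≠ ⊤)
    (hle : ∀ N : ℕ, 5 ≤ N →
      eLpNorm (hausdorff Φ (compSubConstCLM ℂ ((N : ℝ) • e) (bumpSchwartz n))) p volume ≤ C) :
    Tendsto (fun N => eLpNorm (stretchedImage Φ e N) p volume) atTop (𝓝 0) := by
  have hq : 0 < (1 / p).toReal - 1 := by
    rw [one_div, ENNReal.toReal_inv, sub_pos]
    exact (one_lt_inv₀ (ENNReal.toReal_pos hp0 hp1.ne_top)).2
      (ENNReal.toReal_lt_of_lt_ofReal (by simpa using hp1))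
  have hpow : Tendsto (fun N : ℕ => (N : ℝ≥0∞) ^ (1 - (1 / p).toReal)) atTop (𝓝 0) := by
    have := ((ENNReal.tendsto_rpow_at_top hq).comp ENNReal.tendsto_nat_nhds_top).inv
    simpa only [Function.comp_def, ← ENNReal.rpow_neg, neg_sub, ENNReal.inv_top] using this
  have hbound := ENNReal.Tendsto.mul_const hpow (Or.inr hC)
  rw [zero_mul] at hbound
  refine tendsto_of_tendsto_of_tendsto_of_le_of_le' tendsto_const_nhds hbound
    (.of_forall fun _ => zero_le) ?_
  filter_upwards [eventually_ge_atTop 5] with N hN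
  rw [eLpNorm_stretchedImage hΦ he hp1.ne_top hN]
  gcongr
  exact hle N hN

theorem ae_exists_seq_tendsto_stretchedImage (hΦ : LocallyIntegrableOn Φ {0}ᶜ volume)
    (he : ‖e‖ = 1) {p : ℝ≥0∞} (hp0 : p ≠ 0)
    (hlim : Tendsto (fun N => eLpNorm (stretchedImage Φ e N) p volume) atTop (𝓝 0)) :
    ∃ N : ℕ → ℕ, Tendsto N atTop atTop ∧ (∀ k, 5 ≤ N k) ∧
      ∀ᵐ x, Tendsto (fun k => stretchedImage Φ e (N k) x) atTop (𝓝 0) := by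
  have hmeasure : TendstoInMeasure volume (fun k => stretchedImage Φ e (k + 5)) atTop 0 := by
    refine tendstoInMeasure_of_tendsto_eLpNorm hp0
      (fun k => aestronglyMeasurable_stretchedImage hΦ he (by lia))
      aestronglyMeasurable_zero ?_
    simpa only [sub_zero, Function.comp_def] using hlim.comp (tendsto_add_atTop_nat 5)
  obtain ⟨N, hN, hae⟩ := hmeasure.exists_seq_tendsto_ae
  exact ⟨fun k => N k + 5,
    (tendsto_add_atTop_nat 5).comp hN.tendsto_atTop, fun k => by lia, hae⟩

theorem radialDensity_eq_zero_of_tendsto (hΦ : LocallyIntegrableOn Φ {0}ᶜ volume) (he : ‖e‖ = 1)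
    {w : E n} (hw : inner ℝ e w = 0) {s : ℝ} (hs : 0 < s) (hws : ‖w‖ ≤ s / 2)
    (hlebesgue : Tendsto (fun r => ⨍ y in Metric.closedBall s r,
      ‖radialDensity volume Φ y - radialDensity volume Φ s‖) (𝓝[>] 0) (𝓝 0))
    {N : ℕ → ℕ} (hN : Tendsto N atTop atTop) (hN5 : ∀ k, 5 ≤ N k)
    (hlim : Tendsto (fun k => stretchedImage Φ e (N k) (s • e + w)) atTop (𝓝 0)) :
    radialDensity volume Φ s = 0 := by
  have hradius : Tendsto (fun k => 4 * s / (N k : ℝ)) atTop (𝓝[>] 0) := by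
    refine tendsto_nhdsWithin_iff.2
      ⟨tendsto_const_nhds.div_atTop (tendsto_natCast_atTop_atTop.comp hN), .of_forall fun k => ?_⟩
    have : (0 : ℝ) < N k := by exact_mod_cast (by norm_num : 0 < 5).trans_le (hN5 k)
    exact div_pos (by positivity) this
  have hbound := hlim.norm.add ((hlebesgue.comp hradius).const_mul (8 * s))
  rw [norm_zero, mul_zero, add_zero] at hbound
  have hle : s / 2 * ‖radialDensity volume Φ s‖ ≤ 0 := by
    refine ge_of_tendsto' hbound fun k => ?_
    rw [stretchedImage_smul_add hΦ he hw hs (hN5 k)]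
    exact half_mul_norm_le he hw hws (by exact_mod_cast hN5 k) hs
      (locallyIntegrableOn_radialDensity hΦ)
  exact norm_le_zero_iff.1 (nonpos_of_mul_nonpos_right hle (by positivity))

theorem isZeroOperator_of_eLpNorm_hausdorff_le (hΦ : LocallyIntegrableOn Φ {0}ᶜ volume)
    (he : ‖e‖ = 1) {p C : ℝ≥0∞} (hp0 : p ≠ 0) (hp1 : p < 1) (hC : C ≠ ⊤)
    (hle : ∀ N : ℕ, 5 ≤ N →
      eLpNorm (hausdorff Φ (compSubConstCLM ℂ ((N : ℝ) • e) (bumpSchwartz n))) p volume ≤ C) :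
    IsZeroOperator Φ := by
  obtain ⟨N, hN, hN5, hae⟩ := ae_exists_seq_tendsto_stretchedImage hΦ he hp0
    (tendsto_eLpNorm_stretchedImage hΦ he hp0 hp1 hC hle)
  refine isZeroOperator_of_radialDensity_ae_zero ?_
  filter_upwards [ae_restrict_mem measurableSet_Ioi,
    ae_restrict_of_ae (exists_orthogonal_of_ae he hae),
    ae_tendsto_average_norm_sub_of_locallyIntegrableOn isOpen_Ioi
      (locallyIntegrableOn_radialDensity hΦ)] with s hs hslice hlebesgue
  obtain ⟨w, hw, hws, hlim⟩ := hslice hs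
  exact radialDensity_eq_zero_of_tendsto hΦ he hw hs hws hlebesgue hN hN5 hlim

end Concentration

/-! ### Translations of Schwartz functions -/

theorem one_add_norm_sub_le {V : Type*} [SeminormedAddCommGroup V] (x y : V) :
    1 + ‖x - y‖ ≤ (1 + ‖x‖) * (1 + ‖y‖) := by
  nlinarith [norm_sub_le x y, norm_nonneg x, norm_nonneg y]

theorem one_add_norm_le_mul {V : Type*} [SeminormedAddCommGroup V] (x y : V) :
    1 + ‖x‖ ≤ (1 + ‖y‖) * (1 + ‖x - y‖) := by
  nlinarith [norm_le_norm_add_norm_sub' x y, norm_nonneg y, norm_nonneg (x - y)]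

section Translation

variable {𝕜 V F : Type*} [NormedAddCommGroup V] [NormedSpace ℝ V] [NormedAddCommGroup F]
  [NormedSpace ℝ F]

theorem exists_one_add_norm_pow_mul_iteratedFDeriv_le (ψ : 𝓢(V, F)) (k l : ℕ) :
    ∃ C, 0 ≤ C ∧ ∀ x, (1 + ‖x‖) ^ k * ‖iteratedFDeriv ℝ l ψ x‖ ≤ C :=
  ⟨_, by positivity, one_add_le_sup_seminorm_apply (𝕜 := ℝ) (m := (k, l)) le_rfl le_rfl ψ⟩

theorem exists_one_add_norm_pow_mul_le (ψ : 𝓢(V, F)) (k : ℕ) :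
    ∃ C, 0 ≤ C ∧ ∀ x, (1 + ‖x‖) ^ k * ‖ψ x‖ ≤ C := by
  obtain ⟨C, hC, h⟩ := exists_one_add_norm_pow_mul_iteratedFDeriv_le ψ k 0
  exact ⟨C, hC, fun x => by simpa using h x⟩

theorem integrable_one_add_norm_pow_mul [MeasurableSpace V] [BorelSpace V]
    [SecondCountableTopology V] {μ : Measure V} [μ.HasTemperateGrowth] (ψ : 𝓢(V, F)) (k : ℕ) :
    Integrable (fun x => (1 + ‖x‖) ^ k * ‖ψ x‖) μ := by
  have hbinom (x : V) : (1 + ‖x‖) ^ k * ‖ψ x‖ =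
      ∑ i ∈ Finset.range (k + 1), (k.choose i : ℝ) * (‖x‖ ^ i * ‖ψ x‖) := by
    rw [add_comm, add_pow, Finset.sum_mul]
    refine Finset.sum_congr rfl fun i _ => ?_
    rw [one_pow]
    ring
  simp only [hbinom]
  exact integrable_finsetSum _ fun i _ => (ψ.integrable_pow_mul μ i).const_mul _

theorem exists_norm_iteratedFDeriv_sub_le (ψ : 𝓢(V, F)) (k l : ℕ) :
    ∃ C, 0 ≤ C ∧ ∀ z w : V, ‖w - z‖ ≤ 1 →
      (1 + ‖z‖) ^ k * ‖iteratedFDeriv ℝ l ψ w - iteratedFDeriv ℝ l ψ z‖ ≤ C * ‖w - z‖ := by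
  obtain ⟨C, hC, h⟩ := exists_one_add_norm_pow_mul_iteratedFDeriv_le ψ k (l + 1)
  refine ⟨2 ^ k * C, by positivity, fun z w hzw => ?_⟩
  have hderiv : ∀ u ∈ Metric.closedBall z 1,
      ‖fderiv ℝ (iteratedFDeriv ℝ l ψ) u‖ ≤ 2 ^ k * C / (1 + ‖z‖) ^ k := by
    intro u hu
    rw [norm_fderiv_iteratedFDeriv, le_div_iff₀ (by positivity)]
    have hweight : 1 + ‖z‖ ≤ 2 * (1 + ‖u‖) := by
      have : ‖z - u‖ ≤ 1 := by simpa [dist_eq_norm'] using hu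
      nlinarith [one_add_norm_le_mul z u, norm_nonneg u]
    calc ‖iteratedFDeriv ℝ (l + 1) ψ u‖ * (1 + ‖z‖) ^ k
        ≤ ‖iteratedFDeriv ℝ (l + 1) ψ u‖ * (2 * (1 + ‖u‖)) ^ k := by gcongr
      _ = 2 ^ k * ((1 + ‖u‖) ^ k * ‖iteratedFDeriv ℝ (l + 1) ψ u‖) := by rw [mul_pow]; ring
      _ ≤ 2 ^ k * C := by gcongr; exact h u
  have hmvt := (convex_closedBall z 1).norm_image_sub_le_of_norm_fderiv_le
    (fun u _ => (ψ.smooth ⊤).contDiffAt.differentiableAt_iteratedFDeriv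
      (by exact_mod_cast WithTop.coe_lt_top l)) hderiv
    (Metric.mem_closedBall_self zero_le_one) (by simpa [dist_eq_norm] using hzw)
  calc (1 + ‖z‖) ^ k * ‖iteratedFDeriv ℝ l ψ w - iteratedFDeriv ℝ l ψ z‖
      ≤ (1 + ‖z‖) ^ k * (2 ^ k * C / (1 + ‖z‖) ^ k * ‖w - z‖) := by gcongr
    _ = 2 ^ k * C * ‖w - z‖ := by field_simp

variable [RCLike 𝕜] [NormedSpace 𝕜 F]

theorem iteratedFDeriv_compSubConstCLM (ψ : 𝓢(V, F)) (a : V) (l : ℕ) (x : V) :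
    iteratedFDeriv ℝ l (compSubConstCLM 𝕜 a ψ) x = iteratedFDeriv ℝ l ψ (x - a) :=
  iteratedFDeriv_comp_sub l a x

variable (𝕜) [SMulCommClass ℝ 𝕜 F]

theorem exists_seminorm_compSubConstCLM_le (ψ : 𝓢(V, F)) (k l : ℕ) :
    ∃ C, 0 ≤ C ∧ ∀ a,
      SchwartzMap.seminorm 𝕜 k l (compSubConstCLM 𝕜 a ψ) ≤ C * (1 + ‖a‖) ^ k := by
  obtain ⟨C, hC, h⟩ := exists_one_add_norm_pow_mul_iteratedFDeriv_le ψ k l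
  refine ⟨C, hC, fun a => seminorm_le_bound 𝕜 k l _ (by positivity) fun x => ?_⟩
  rw [iteratedFDeriv_compSubConstCLM]
  calc ‖x‖ ^ k * ‖iteratedFDeriv ℝ l ψ (x - a)‖
      ≤ ((1 + ‖a‖) * (1 + ‖x - a‖)) ^ k * ‖iteratedFDeriv ℝ l ψ (x - a)‖ := by
        gcongr
        linarith [one_add_norm_le_mul x a]
    _ = (1 + ‖a‖) ^ k * ((1 + ‖x - a‖) ^ k * ‖iteratedFDeriv ℝ l ψ (x - a)‖) := by
        rw [mul_pow]; ring
    _ ≤ (1 + ‖a‖) ^ k * C := by gcongr; exact h _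
    _ = C * (1 + ‖a‖) ^ k := mul_comm _ _

theorem exists_sup_seminorm_compSubConstCLM_le (ψ : 𝓢(V, F)) (s : Finset (ℕ × ℕ)) :
    ∃ C, 0 ≤ C ∧ ∀ a, s.sup (schwartzSeminormFamily 𝕜 V F) (compSubConstCLM 𝕜 a ψ) ≤
      C * (1 + ‖a‖) ^ s.sup Prod.fst := by
  choose B hB0 hB using fun i : ℕ × ℕ => exists_seminorm_compSubConstCLM_le 𝕜 ψ i.1 i.2
  have hsum0 : 0 ≤ ∑ i ∈ s, B i := Finset.sum_nonneg fun i _ => hB0 i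
  refine ⟨∑ i ∈ s, B i, hsum0, fun a => Seminorm.finset_sup_apply_le (by positivity)
    fun i hi => (hB i a).trans ?_⟩
  gcongr
  · exact Finset.single_le_sum (f := B) (fun i _ => hB0 i) hi
  · linarith [norm_nonneg a]
  · exact Finset.le_sup (f := Prod.fst) hi

theorem exists_seminorm_compSubConstCLM_sub_le (ψ : 𝓢(V, F)) (k l : ℕ) :
    ∃ C, 0 ≤ C ∧ ∀ a b : V, ‖a - b‖ ≤ 1 →
      SchwartzMap.seminorm 𝕜 k l (compSubConstCLM 𝕜 a ψ - compSubConstCLM 𝕜 b ψ) ≤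
        C * (1 + ‖b‖) ^ k * ‖a - b‖ := by
  obtain ⟨C, hC, h⟩ := exists_norm_iteratedFDeriv_sub_le ψ k l
  refine ⟨C, hC, fun a b hab => seminorm_le_bound 𝕜 k l _ (by positivity) fun x => ?_⟩
  have hshift : ‖(x - a) - (x - b)‖ = ‖a - b‖ := by rw [sub_sub_sub_cancel_left, norm_sub_rev]
  have hderiv : iteratedFDeriv ℝ l (compSubConstCLM 𝕜 a ψ - compSubConstCLM 𝕜 b ψ : 𝓢(V, F)) x =
      iteratedFDeriv ℝ l ψ (x - a) - iteratedFDeriv ℝ l ψ (x - b) := by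
    rw [← iteratedFDeriv_compSubConstCLM (𝕜 := 𝕜), ← iteratedFDeriv_compSubConstCLM (𝕜 := 𝕜)]
    exact iteratedFDeriv_sub_apply ((compSubConstCLM 𝕜 a ψ).contDiffAt l)
      ((compSubConstCLM 𝕜 b ψ).contDiffAt l)
  have hlip := h (x - b) (x - a) (hshift.trans_le hab)
  rw [hderiv]
  rw [hshift] at hlip
  calc ‖x‖ ^ k * ‖iteratedFDeriv ℝ l ψ (x - a) - iteratedFDeriv ℝ l ψ (x - b)‖
      ≤ ((1 + ‖b‖) * (1 + ‖x - b‖)) ^ k *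
          ‖iteratedFDeriv ℝ l ψ (x - a) - iteratedFDeriv ℝ l ψ (x - b)‖ := by
        gcongr
        linarith [one_add_norm_le_mul x b]
    _ = (1 + ‖b‖) ^ k * ((1 + ‖x - b‖) ^ k *
          ‖iteratedFDeriv ℝ l ψ (x - a) - iteratedFDeriv ℝ l ψ (x - b)‖) := by
        rw [mul_pow]; ring
    _ ≤ (1 + ‖b‖) ^ k * (C * ‖a - b‖) := by gcongr
    _ = C * (1 + ‖b‖) ^ k * ‖a - b‖ := by ring

theorem continuous_compSubConstCLM (ψ : 𝓢(V, F)) :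
    Continuous fun a : V => compSubConstCLM 𝕜 a ψ := by
  rw [continuous_iff_continuousAt]
  intro b
  rw [ContinuousAt, (schwartz_withSeminorms 𝕜 V F).tendsto_nhds]
  rintro ⟨k, l⟩ ε hε
  obtain ⟨C, -, hC⟩ := exists_seminorm_compSubConstCLM_sub_le 𝕜 ψ k l
  have hlim : Tendsto (fun a : V => C * (1 + ‖b‖) ^ k * ‖a - b‖) (𝓝 b) (𝓝 0) :=
    Continuous.tendsto' (by fun_prop) _ _ (by simp)
  filter_upwards [hlim.eventually_lt_const hε, Metric.closedBall_mem_nhds b one_pos] with a ha hab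
  exact (hC a b (by simpa [dist_eq_norm] using hab)).trans_lt ha

end Translation

/-! ### Convolution with a tempered distribution -/

section Conv

variable {n : ℕ}

theorem exists_norm_le_sup_seminorm (v : 𝓢'(E n, ℂ)) :
    ∃ (s : Finset (ℕ × ℕ)) (C : ℝ), 0 ≤ C ∧ ∀ f : 𝓢(E n, ℂ),
      ‖v f‖ ≤ C * s.sup (schwartzSeminormFamily ℂ (E n) ℂ) f := by
  obtain ⟨s, C, -, h⟩ := Seminorm.bound_of_continuous (schwartz_withSeminorms ℂ (E n) ℂ)
    ((normSeminorm ℂ ℂ).comp (v : 𝓢(E n, ℂ) →ₗ[ℂ] ℂ)) (continuous_norm.comp v.continuous)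
  exact ⟨s, C, C.2, h⟩

theorem continuous_conv (ψ : 𝓢(E n, ℂ)) (v : 𝓢'(E n, ℂ)) : Continuous (conv ψ v) :=
  v.continuous.comp (continuous_compSubConstCLM ℂ _)

theorem exists_norm_conv_le_one_add_norm_pow (v : 𝓢'(E n, ℂ)) :
    ∃ N : ℕ, ∀ ψ : 𝓢(E n, ℂ), ∃ A, 0 ≤ A ∧ ∀ x, ‖conv ψ v x‖ ≤ A * (1 + ‖x‖) ^ N := by
  obtain ⟨s, C, hC, h⟩ := exists_norm_le_sup_seminorm v
  refine ⟨s.sup Prod.fst, fun ψ => ?_⟩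
  obtain ⟨B, hB, hle⟩ := exists_sup_seminorm_compSubConstCLM_le ℂ
    (compCLMOfContinuousLinearEquiv ℂ (ContinuousLinearEquiv.neg ℝ (M := E n)) ψ) s
  refine ⟨C * B, by positivity, fun x => (h _).trans ?_⟩
  rw [mul_assoc]
  gcongr
  exact hle x

end Conv

/-! ### Approximate identities -/

section Localization

variable {V : Type*} [NormedAddCommGroup V] [NormedSpace ℝ V]

theorem sub_smulLeftCLM_apply (χ F : 𝓢(V, ℂ)) (y : V) :
    (F - smulLeftCLM ℂ χ F) y = F y - χ y * F y := by
  simp [smulLeftCLM_apply_apply χ.hasTemperateGrowth]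

theorem exists_norm_iteratedFDeriv_sub_smulLeftCLM_le (χ : 𝓢(V, ℂ)) (l : ℕ) :
    ∃ B, 0 ≤ B ∧ ∀ (F : 𝓢(V, ℂ)) (y : V) (M : ℝ), (∀ j ≤ l, ‖iteratedFDeriv ℝ j F y‖ ≤ M) →
      ‖iteratedFDeriv ℝ l (F - smulLeftCLM ℂ χ F) y‖ ≤ B * M := by
  refine ⟨1 + ∑ i ∈ Finset.range (l + 1), (l.choose i : ℝ) * SchwartzMap.seminorm ℂ 0 i χ,
    by positivity, fun F y M hM => ?_⟩
  have hcoe : ⇑(F - smulLeftCLM ℂ χ F) = ⇑F - fun y => χ y * F y :=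
    funext (sub_smulLeftCLM_apply χ F)
  rw [hcoe, iteratedFDeriv_sub_apply (F.smooth l).contDiffAt
    ((χ.smooth l).mul (F.smooth l)).contDiffAt, add_mul, one_mul, Finset.sum_mul]
  refine (norm_sub_le _ _).trans (add_le_add (hM l le_rfl) ?_)
  refine (norm_iteratedFDeriv_mul_le (χ.smooth l) (F.smooth l) y le_rfl).trans ?_
  gcongr with i
  · exact norm_iteratedFDeriv_le_seminorm ℂ χ i y
  · exact hM _ (Nat.sub_le _ _)

theorem iteratedFDeriv_sub_smulLeftCLM_eq_zero {χ : 𝓢(V, ℂ)} {y : V} (hχ : χ =ᶠ[𝓝 y] 1)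
    (F : 𝓢(V, ℂ)) (l : ℕ) : iteratedFDeriv ℝ l (F - smulLeftCLM ℂ χ F) y = 0 := by
  have hzero : ⇑(F - smulLeftCLM ℂ χ F) =ᶠ[𝓝 y] 0 := by
    filter_upwards [hχ] with z hz
    rw [sub_smulLeftCLM_apply, hz, Pi.one_apply, one_mul, sub_self, Pi.zero_apply]
  rw [(hzero.iteratedFDeriv ℝ l).eq_of_nhds, iteratedFDeriv_zero, Pi.zero_apply]

end Localization

section ApproxId

variable {n : ℕ}

theorem approxId_apply (ψ : 𝓢(E n, ℂ)) {t : ℝ} (ht : 0 < t) (x : E n) :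
    approxId ψ t ht x = (((t ^ n)⁻¹ : ℝ) : ℂ) * ψ (t⁻¹ • x) := rfl

theorem integral_approxId_mul (ψ : 𝓢(E n, ℂ)) {t : ℝ} (ht : 0 < t) (F : E n → ℂ) :
    ∫ y, approxId ψ t ht y * F y = ∫ z, ψ z * F (t • z) := by
  have hjac : (((t ^ n)⁻¹ : ℝ) : ℂ) ≠ 0 := by exact_mod_cast (inv_pos.2 (pow_pos ht n)).ne'
  have hscale := Measure.integral_comp_smul volume (fun y => approxId ψ t ht y * F y) t
  simp only [approxId_apply, smul_smul, inv_mul_cancel₀ ht.ne', one_smul, mul_assoc,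
    integral_const_mul] at hscale ⊢
  rw [finrank_euclideanSpace_fin, abs_of_pos (inv_pos.2 (pow_pos ht n)), Complex.real_smul]
    at hscale
  exact (mul_left_cancel₀ hjac hscale).symm

theorem norm_iteratedFDeriv_reflectAt (ψ : 𝓢(E n, ℂ)) (l : ℕ) (x y : E n) :
    ‖iteratedFDeriv ℝ l (reflectAt ψ x) y‖ = ‖iteratedFDeriv ℝ l ψ (x - y)‖ := by
  have hcoe : ⇑(compCLMOfContinuousLinearEquiv ℂ (ContinuousLinearEquiv.neg ℝ (M := E n)) ψ) =
      ψ ∘ LinearIsometryEquiv.neg ℝ := rfl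
  rw [reflectAt, iteratedFDeriv_compSubConstCLM, hcoe,
    LinearIsometryEquiv.norm_iteratedFDeriv_comp_right]
  simp only [LinearIsometryEquiv.coe_neg, neg_sub]

theorem norm_iteratedFDeriv_approxId (ψ : 𝓢(E n, ℂ)) {t : ℝ} (ht : 0 < t) (j : ℕ) (x : E n) :
    ‖iteratedFDeriv ℝ j (approxId ψ t ht) x‖ =
      (t ^ n)⁻¹ * ((t⁻¹) ^ j * ‖iteratedFDeriv ℝ j ψ (t⁻¹ • x)‖) := by
  have hcoe : ⇑(approxId ψ t ht) = (((t ^ n)⁻¹ : ℝ) : ℂ) • fun x => ψ (t⁻¹ • x) := rfl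
  have hsmooth : ContDiff ℝ j fun x => ψ (t⁻¹ • x) := (ψ.smooth j).comp (contDiff_const_smul _)
  rw [hcoe, iteratedFDeriv_const_smul_apply hsmooth.contDiffAt, norm_smul,
    iteratedFDeriv_comp_const_smul _ (ψ.smooth j), norm_smul, Complex.norm_real, norm_pow,
    Real.norm_of_nonneg (by positivity), Real.norm_of_nonneg (by positivity)]

theorem norm_iteratedFDeriv_approxId_le (ψ : 𝓢(E n, ℂ)) {A j : ℕ} (hA : n + j + 1 ≤ A) {t : ℝ}
    (ht : 0 < t) (ht1 : t ≤ 1) {z : E n} (hz : z ≠ 0) :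
    ‖iteratedFDeriv ℝ j (approxId ψ t ht) z‖ ≤
      SchwartzMap.seminorm ℂ A j ψ * t * (‖z‖ ^ A)⁻¹ := by
  have hdecay : ‖iteratedFDeriv ℝ j ψ (t⁻¹ • z)‖ ≤
      SchwartzMap.seminorm ℂ A j ψ * (t ^ A * (‖z‖ ^ A)⁻¹) := by
    have hle := le_seminorm ℂ A j ψ (t⁻¹ • z)
    rw [norm_smul, norm_inv, Real.norm_of_nonneg ht.le, mul_pow, inv_pow] at hle
    calc ‖iteratedFDeriv ℝ j ψ (t⁻¹ • z)‖
        = (t ^ A)⁻¹ * ‖z‖ ^ A * ‖iteratedFDeriv ℝ j ψ (t⁻¹ • z)‖ * (t ^ A * (‖z‖ ^ A)⁻¹) := by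
          field_simp
      _ ≤ _ := by gcongr
  have hpow : (t ^ n)⁻¹ * ((t⁻¹) ^ j * t ^ A) ≤ t := by
    obtain ⟨d, rfl⟩ := Nat.exists_eq_add_of_le hA
    calc (t ^ n)⁻¹ * ((t⁻¹) ^ j * t ^ (n + j + 1 + d)) = t * t ^ d := by
          rw [pow_add, pow_add, pow_add, inv_pow]
          field_simp
      _ ≤ t := mul_le_of_le_one_right ht.le (pow_le_one₀ ht.le ht1)
  rw [norm_iteratedFDeriv_approxId]
  calc (t ^ n)⁻¹ * ((t⁻¹) ^ j * ‖iteratedFDeriv ℝ j ψ (t⁻¹ • z)‖)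
      ≤ (t ^ n)⁻¹ * ((t⁻¹) ^ j * (SchwartzMap.seminorm ℂ A j ψ * (t ^ A * (‖z‖ ^ A)⁻¹))) := by
        gcongr
    _ = SchwartzMap.seminorm ℂ A j ψ * ((t ^ n)⁻¹ * ((t⁻¹) ^ j * t ^ A)) * (‖z‖ ^ A)⁻¹ := by ring
    _ ≤ SchwartzMap.seminorm ℂ A j ψ * t * (‖z‖ ^ A)⁻¹ := by gcongr

theorem exists_seminorm_reflectAt_approxId_sub_smulLeftCLM_le (ψ : 𝓢(E n, ℂ)) {χ : 𝓢(E n, ℂ)}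
    {x₀ : E n} (hχ : χ =ᶠ[𝓝 x₀] 1) (k l : ℕ) :
    ∃ C, ∀ (t : ℝ) (ht : 0 < t), t ≤ 1 →
      SchwartzMap.seminorm ℂ k l (reflectAt (approxId ψ t ht) x₀ -
        smulLeftCLM ℂ χ (reflectAt (approxId ψ t ht) x₀)) ≤ C * t := by
  obtain ⟨ρ, hρ, hball⟩ := Metric.eventually_nhds_iff_ball.1 (eventually_eventually_nhds.2 hχ)
  obtain ⟨B, hB0, hB⟩ := exists_norm_iteratedFDeriv_sub_smulLeftCLM_le χ l
  set A := n + l + 1 + k with hA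
  set T := ∑ j ∈ Finset.range (l + 1), SchwartzMap.seminorm ℂ A j ψ
  refine ⟨B * T * ((‖x₀‖ / ρ + 1) ^ k * (ρ ^ (n + l + 1))⁻¹), fun t ht ht1 =>
    seminorm_le_bound ℂ k l _ (by positivity) fun y => ?_⟩
  by_cases hy : y ∈ Metric.ball x₀ ρ
  · rw [iteratedFDeriv_sub_smulLeftCLM_eq_zero (hball y hy), norm_zero, mul_zero]
    positivity
  have hρy : ρ ≤ ‖x₀ - y‖ := by simpa [dist_eq_norm'] using hy
  have hq : 0 < ‖x₀ - y‖ := hρ.trans_le hρy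
  have hderiv := hB (reflectAt (approxId ψ t ht) x₀) y (T * t * (‖x₀ - y‖ ^ A)⁻¹) fun j hj => by
    rw [norm_iteratedFDeriv_reflectAt]
    refine (norm_iteratedFDeriv_approxId_le ψ (A := A) (by omega) ht ht1
      (norm_pos_iff.1 hq)).trans ?_
    gcongr
    exact Finset.single_le_sum (f := fun j => SchwartzMap.seminorm ℂ A j ψ)
      (fun j _ => apply_nonneg _ _) (Finset.mem_range_succ_iff.2 hj)
  have hnorm : ‖y‖ ≤ (‖x₀‖ / ρ + 1) * ‖x₀ - y‖ := by
    have : ‖x₀‖ ≤ ‖x₀‖ / ρ * ‖x₀ - y‖ := by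
      rw [div_mul_eq_mul_div, le_div_iff₀ hρ]
      gcongr
    linarith [norm_le_norm_add_norm_sub x₀ y]
  calc _ ≤ ((‖x₀‖ / ρ + 1) * ‖x₀ - y‖) ^ k * (B * (T * t * (‖x₀ - y‖ ^ A)⁻¹)) := by gcongr
    _ = B * T * ((‖x₀‖ / ρ + 1) ^ k * (‖x₀ - y‖ ^ (n + l + 1))⁻¹) * t := by
        rw [mul_pow, hA, pow_add ‖x₀ - y‖ (n + l + 1) k]
        field_simp
    _ ≤ B * T * ((‖x₀‖ / ρ + 1) ^ k * (ρ ^ (n + l + 1))⁻¹) * t := by gcongr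

theorem tendsto_reflectAt_approxId_sub_smulLeftCLM (ψ : 𝓢(E n, ℂ)) {χ : 𝓢(E n, ℂ)} {x₀ : E n}
    (hχ : χ =ᶠ[𝓝 x₀] 1) {t : ℕ → ℝ} (ht : ∀ j, 0 < t j) (ht1 : ∀ j, t j ≤ 1)
    (hlim : Tendsto t atTop (𝓝 0)) :
    Tendsto (fun j => reflectAt (approxId ψ (t j) (ht j)) x₀ -
      smulLeftCLM ℂ χ (reflectAt (approxId ψ (t j) (ht j)) x₀)) atTop (𝓝 0) := by
  rw [(schwartz_withSeminorms ℂ (E n) ℂ).tendsto_nhds]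
  rintro ⟨k, l⟩ ε hε
  obtain ⟨C, hC⟩ := exists_seminorm_reflectAt_approxId_sub_smulLeftCLM_le ψ hχ k l
  have hlim0 : Tendsto (fun j => C * t j) atTop (𝓝 0) := by simpa using hlim.const_mul C
  filter_upwards [hlim0.eventually_lt_const hε] with j hj
  rw [sub_zero]
  exact (hC (t j) (ht j) (ht1 j)).trans_lt hj

end ApproxId

section Growth

variable {V : Type*} [NormedAddCommGroup V] [NormedSpace ℝ V] {F : V → ℂ} {A : ℝ} {N : ℕ}

theorem norm_mul_comp_sub_smul_le (hF : ∀ y, ‖F y‖ ≤ A * (1 + ‖y‖) ^ N) {t : ℝ} (ht : 0 < t)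
    (ht1 : t ≤ 1) (κ : V → ℂ) (x z : V) :
    ‖κ z * F (x - t • z)‖ ≤ A * (1 + ‖x‖) ^ N * ((1 + ‖z‖) ^ N * ‖κ z‖) := by
  have hA : 0 ≤ A := by simpa using (norm_nonneg _).trans (hF 0)
  have hweight : 1 + ‖x - t • z‖ ≤ (1 + ‖x‖) * (1 + ‖z‖) := by
    refine (one_add_norm_sub_le x _).trans ?_
    gcongr
    rw [norm_smul, Real.norm_of_nonneg ht.le]
    exact mul_le_of_le_one_left (norm_nonneg z) ht1
  rw [norm_mul]
  calc ‖κ z‖ * ‖F (x - t • z)‖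
      ≤ ‖κ z‖ * (A * ((1 + ‖x‖) * (1 + ‖z‖)) ^ N) := by
        gcongr
        exact (hF _).trans (by gcongr)
    _ = A * (1 + ‖x‖) ^ N * ((1 + ‖z‖) ^ N * ‖κ z‖) := by rw [mul_pow]; ring

variable [FiniteDimensional ℝ V]

theorem exists_schwartz_eventuallyEq_one_norm_mul_le {g : V → ℂ} {x₀ : V}
    (hg : ContinuousAt g x₀) :
    ∃ χ : 𝓢(V, ℂ), HasCompactSupport χ ∧ χ =ᶠ[𝓝 x₀] 1 ∧ ∃ A, ∀ y, ‖χ y * g y‖ ≤ A := by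
  obtain ⟨δ, hδ, hball⟩ := Metric.mem_nhds_iff.1
    (hg.norm.eventually_lt_const (lt_add_one ‖g x₀‖))
  let b : ContDiffBump x₀ := ⟨δ / 2, δ, half_pos hδ, half_lt_self hδ⟩
  have hsupp : HasCompactSupport fun y => (b y : ℂ) :=
    b.hasCompactSupport.comp_left (g := Complex.ofReal) Complex.ofReal_zero
  refine ⟨hsupp.toSchwartzMap (Complex.ofRealCLM.contDiff.comp b.contDiff), hsupp, ?_,
    ‖g x₀‖ + 1, fun y => ?_⟩
  · filter_upwards [b.eventuallyEq_one] with y hy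
    exact congrArg Complex.ofReal hy
  · change ‖(b y : ℂ) * g y‖ ≤ _
    rw [norm_mul, Complex.norm_real, Real.norm_of_nonneg b.nonneg]
    by_cases hy : y ∈ Metric.ball x₀ δ
    · exact (mul_le_of_le_one_left (norm_nonneg _) b.le_one).trans (hball hy).le
    · rw [b.zero_of_le_dist (not_lt.1 hy), zero_mul]
      positivity

variable [MeasurableSpace V] [BorelSpace V] {μ : Measure V}
  [μ.IsAddHaarMeasure]

theorem norm_integral_mul_comp_sub_smul_le (hF : ∀ y, ‖F y‖ ≤ A * (1 + ‖y‖) ^ N) {t : ℝ}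
    (ht : 0 < t) (ht1 : t ≤ 1) (κ : 𝓢(V, ℂ)) (x : V) :
    ‖∫ z, κ z * F (x - t • z) ∂μ‖ ≤
      A * (1 + ‖x‖) ^ N * ∫ z, (1 + ‖z‖) ^ N * ‖κ z‖ ∂μ := by
  rw [← integral_const_mul]
  exact norm_integral_le_of_norm_le ((integrable_one_add_norm_pow_mul κ N).const_mul _)
    (Eventually.of_forall (norm_mul_comp_sub_smul_le hF ht ht1 κ x))

theorem tendsto_integral_mul_comp_sub_smul (hFm : AEStronglyMeasurable F μ)
    (hF : ∀ y, ‖F y‖ ≤ A * (1 + ‖y‖) ^ N) (κ : 𝓢(V, ℂ)) {x : V} (hFx : ContinuousAt F x)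
    {t : ℕ → ℝ} (ht : ∀ j, 0 < t j) (ht1 : ∀ j, t j ≤ 1) (hlim : Tendsto t atTop (𝓝 0)) :
    Tendsto (fun j => ∫ z, κ z * F (x - t j • z) ∂μ) atTop (𝓝 ((∫ z, κ z ∂μ) * F x)) := by
  rw [← integral_mul_const]
  refine tendsto_integral_of_dominated_convergence _ (fun j => ?_)
    ((integrable_one_add_norm_pow_mul κ N).const_mul _)
    (fun j => Eventually.of_forall (norm_mul_comp_sub_smul_le hF (ht j) (ht1 j) κ x))
    (Eventually.of_forall fun z => Tendsto.const_mul _ ?_)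
  · exact κ.continuous.aestronglyMeasurable.mul (hFm.comp_quasiMeasurePreserving
      ((quasiMeasurePreserving_sub_left μ x).comp
        (Measure.quasiMeasurePreserving_smul μ (ht j).ne')))
  · exact hFx.tendsto.comp (by simpa using (hlim.smul_const z).const_sub x)

end Growth

section Represents

variable {n : ℕ} {g : E n → ℂ} {v : 𝓢'(E n, ℂ)}

theorem Represents.apply_smulLeftCLM_reflectAt_approxId (hgv : Represents g v)
    {χ : 𝓢(E n, ℂ)} (hχ : HasCompactSupport χ) (ψ : 𝓢(E n, ℂ)) {t : ℝ} (ht : 0 < t) (x : E n) :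
    v (smulLeftCLM ℂ χ (reflectAt (approxId ψ t ht) x)) =
      ∫ z, ψ z * (χ (x - t • z) * g (x - t • z)) := by
  have hcoe : ⇑(smulLeftCLM ℂ χ (reflectAt (approxId ψ t ht) x)) =
      fun y => χ y * approxId ψ t ht (x - y) := by
    ext y
    rw [smulLeftCLM_apply_apply χ.hasTemperateGrowth, reflectAt_apply, smul_eq_mul]
  rw [hgv.2 _ (by rw [hcoe]; exact hχ.mul_right), hcoe,
    ← integral_approxId_mul ψ ht fun y => χ (x - y) * g (x - y),
    ← integral_sub_left_eq_self _ volume x]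
  refine integral_congr_ae (Eventually.of_forall fun y => ?_)
  simp only [sub_sub_cancel]
  ring

/-- Localizing near `x₀` makes `g` bounded; the tail is negligible since `ψ_t(x₀ - ·)` tends to
`0` in the Schwartz space away from `x₀`. -/
theorem Represents.tendsto_conv_approxId (hgv : Represents g v) {x₀ : E n}
    (hg : ContinuousAt g x₀) (ψ : 𝓢(E n, ℂ)) {t : ℕ → ℝ} (ht : ∀ j, 0 < t j)
    (ht1 : ∀ j, t j ≤ 1) (hlim : Tendsto t atTop (𝓝 0)) :
    Tendsto (fun j => conv (approxId ψ (t j) (ht j)) v x₀) atTop (𝓝 ((∫ x, ψ x) * g x₀)) := by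
  obtain ⟨χ, hχ, hχ1, A, hA⟩ := exists_schwartz_eventuallyEq_one_norm_mul_le hg
  have hlocal := tendsto_integral_mul_comp_sub_smul (F := fun y => χ y * g y)
    (χ.continuous.aestronglyMeasurable.mul hgv.1.aestronglyMeasurable) (N := 0) (A := A)
    (by simpa using hA) ψ (χ.continuous.continuousAt.mul hg) ht ht1 hlim
  have htail : Tendsto (fun j => v (reflectAt (approxId ψ (t j) (ht j)) x₀ -
      smulLeftCLM ℂ χ (reflectAt (approxId ψ (t j) (ht j)) x₀))) atTop (𝓝 0) := by
    rw [← map_zero v]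
    exact (v.continuous.tendsto 0).comp
      (tendsto_reflectAt_approxId_sub_smulLeftCLM ψ hχ1 ht ht1 hlim)
  have hsum := hlocal.add htail
  rw [hχ1.eq_of_nhds, Pi.one_apply, one_mul, add_zero] at hsum
  refine hsum.congr fun j => ?_
  rw [← hgv.apply_smulLeftCLM_reflectAt_approxId hχ ψ (ht j) x₀, ← map_add,
    add_sub_cancel]
  rfl

end Represents

/-! ### Iterated convolutions -/

theorem exists_eq_comp_of_norm_le {𝕜 M F : Type*} [RCLike 𝕜] [AddCommGroup M] [Module 𝕜 M]
    [NormedAddCommGroup F] [NormedSpace 𝕜 F] (L : M →ₗ[𝕜] 𝕜) (ι : M →ₗ[𝕜] F) {C : ℝ}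
    (hL : ∀ f, ‖L f‖ ≤ C * ‖ι f‖) : ∃ G : F →L[𝕜] 𝕜, ∀ f, L f = G (ι f) := by
  have hker : ι.ker ≤ L.ker := fun f hf => by
    have hle := hL f
    rw [LinearMap.mem_ker.1 hf, norm_zero, mul_zero] at hle
    exact norm_le_zero_iff.1 hle
  let g₀ : ι.range →ₗ[𝕜] 𝕜 := (ι.ker.liftQ L hker) ∘ₗ ι.quotKerEquivRange.symm.toLinearMap
  have hg₀ (f : M) : g₀ ⟨ι f, f, rfl⟩ = L f := by
    have hmk : ι.quotKerEquivRange.symm ⟨ι f, f, rfl⟩ = ι.ker.mkQ f := by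
      rw [LinearEquiv.symm_apply_eq]
      rfl
    rw [LinearMap.comp_apply, LinearEquiv.coe_coe, hmk, Submodule.mkQ_apply, Submodule.liftQ_apply]
  let g : ι.range →L[𝕜] 𝕜 := g₀.mkContinuous C (by
    rintro ⟨_, f, rfl⟩
    rw [hg₀]
    exact hL f)
  obtain ⟨G, hG, -⟩ := exists_extension_norm_eq ι.range g
  exact ⟨G, fun f => (hg₀ f).symm.trans (hG ⟨ι f, f, rfl⟩).symm⟩

section WeightedDeriv

variable {V F : Type*} [NormedAddCommGroup V] [NormedSpace ℝ V] [NormedAddCommGroup F]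
  [NormedSpace ℝ F] [NormedSpace ℂ F] [SMulCommClass ℝ ℂ F]

theorem norm_smul_iteratedFDeriv_le_sup {s : Finset (ℕ × ℕ)} (f : 𝓢(V, F)) {i : ℕ × ℕ}
    (hi : i ∈ s) (x : V) :
    ‖‖x‖ ^ i.1 • iteratedFDeriv ℝ i.2 f x‖ ≤ s.sup (schwartzSeminormFamily ℂ V F) f := by
  rw [norm_smul, norm_pow, norm_norm]
  exact (le_seminorm ℂ i.1 i.2 f x).trans
    (Seminorm.le_finset_sup_apply (p := schwartzSeminormFamily ℂ V F) hi)

/-- The functions `x ↦ ‖x‖ ^ k • D^l f(x)` with `(k, l)` in `s`, as one element of an `ℓ^∞` space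
in which its norm is the supremum of the Schwartz seminorms of `f` with indices in `s`. -/
def weightedDerivs (s : Finset (ℕ × ℕ)) :
    𝓢(V, F) →L[ℂ] lp (fun q : s × V => V [×q.1.1.2]→L[ℝ] F) ⊤ :=
  mkCLMtoNormedSpace (σ := RingHom.id ℂ)
    (fun f => ⟨fun q => ‖q.2‖ ^ q.1.1.1 • iteratedFDeriv ℝ q.1.1.2 f q.2,
      memℓp_infty ⟨_, forall_mem_range.2 fun q => norm_smul_iteratedFDeriv_le_sup f q.1.2 q.2⟩⟩)
    (fun f g => by
      ext1
      funext q
      exact (congrArg _ (iteratedFDeriv_add_apply (f.smooth _).contDiffAt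
        (g.smooth _).contDiffAt)).trans (smul_add _ _ _))
    (fun a f => by
      ext1
      funext q
      exact (congrArg _ (iteratedFDeriv_const_smul_apply (f.smooth _).contDiffAt)).trans
        (smul_comm _ _ _))
    ⟨s, 1, zero_le_one, fun f => by
      rw [one_mul]
      exact lp.norm_le_of_forall_le (apply_nonneg _ _) fun q =>
        norm_smul_iteratedFDeriv_le_sup f q.1.2 q.2⟩

theorem weightedDerivs_apply (s : Finset (ℕ × ℕ)) (f : 𝓢(V, F)) (q : s × V) :
    weightedDerivs s f q = ‖q.2‖ ^ q.1.1.1 • iteratedFDeriv ℝ q.1.1.2 f q.2 := rfl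

theorem norm_weightedDerivs (s : Finset (ℕ × ℕ)) (f : 𝓢(V, F)) :
    ‖weightedDerivs s f‖ = s.sup (schwartzSeminormFamily ℂ V F) f := by
  refine le_antisymm (lp.norm_le_of_forall_le (apply_nonneg _ _) fun q =>
    norm_smul_iteratedFDeriv_le_sup f q.1.2 q.2) ?_
  refine Seminorm.finset_sup_apply_le (norm_nonneg _) fun i hi =>
    seminorm_le_bound ℂ i.1 i.2 f (norm_nonneg _) fun x => ?_
  have hle := lp.norm_apply_le_norm ENNReal.top_ne_zero (weightedDerivs s f) (⟨i, hi⟩, x)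
  rwa [weightedDerivs_apply, norm_smul, norm_pow, norm_norm] at hle

end WeightedDeriv

section Convolution

variable {V F₁ F₂ F₃ : Type*} [NormedAddCommGroup V] [InnerProductSpace ℝ V]
  [FiniteDimensional ℝ V] [MeasurableSpace V] [BorelSpace V]
  [NormedAddCommGroup F₁] [NormedSpace ℂ F₁] [NormedAddCommGroup F₂] [NormedSpace ℂ F₂]
  [NormedAddCommGroup F₃] [NormedSpace ℂ F₃] [CompleteSpace F₃] (B : F₁ →L[ℂ] F₂ →L[ℂ] F₃)

theorem lineDerivOp_convolution (f : 𝓢(V, F₁)) (g : 𝓢(V, F₂)) (m : V) :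
    ∂_{m} (convolution B f g) = convolution B f (∂_{m} g) := by
  have hm : (inner ℝ · m : V → ℝ).HasTemperateGrowth := by fun_prop
  refine (FourierTransform.fourierEquiv ℂ 𝓢(V, F₃)).injective ?_
  change 𝓕 (∂_{m} (convolution B f g)) = 𝓕 (convolution B f (∂_{m} g))
  rw [fourier_lineDerivOp_eq, fourier_convolution, fourier_convolution, fourier_lineDerivOp_eq]
  ext ξ
  simp [pairing_apply_apply, smulLeftCLM_apply_apply hm]

theorem iteratedFDeriv_convolution_apply [CompleteSpace F₁] [CompleteSpace F₂] (f : 𝓢(V, F₁))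
    (g : 𝓢(V, F₂)) {l : ℕ} (x : V) (m : Fin l → V) :
    iteratedFDeriv ℝ l (convolution B f g) x m =
      ∫ y, B (f y) (iteratedFDeriv ℝ l g (x - y) m) := by
  have hderiv : ∂^{m} (convolution B f g) = convolution B f (∂^{m} g) := by
    induction l with
    | zero => simp
    | succ l ih =>
      rw [LineDeriv.iteratedLineDerivOp_succ_left, LineDeriv.iteratedLineDerivOp_succ_left, ih,
        lineDerivOp_convolution]
  rw [← iteratedLineDerivOp_eq_iteratedFDeriv, hderiv, convolution_apply]
  simp only [← iteratedLineDerivOp_eq_iteratedFDeriv]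
  rfl

end Convolution

section ApplyConvolution

variable {n : ℕ} (κ κ' : 𝓢(E n, ℂ))

theorem integrable_smul_weightedDerivs_compSubConstCLM (s : Finset (ℕ × ℕ)) :
    Integrable fun y => κ y • weightedDerivs s (compSubConstCLM ℂ y κ') := by
  obtain ⟨C, -, hC⟩ := exists_sup_seminorm_compSubConstCLM_le ℂ κ' s
  refine ((integrable_one_add_norm_pow_mul κ (s.sup Prod.fst)).const_mul C).mono'
    (κ.continuous.smul ((weightedDerivs s).continuous.comp
      (continuous_compSubConstCLM ℂ κ'))).aestronglyMeasurable
    (Eventually.of_forall fun y => ?_)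
  rw [norm_smul, norm_weightedDerivs]
  calc ‖κ y‖ * s.sup (schwartzSeminormFamily ℂ (E n) ℂ) (compSubConstCLM ℂ y κ')
      ≤ ‖κ y‖ * (C * (1 + ‖y‖) ^ s.sup Prod.fst) := by gcongr; exact hC y
    _ = C * ((1 + ‖y‖) ^ s.sup Prod.fst * ‖κ y‖) := by ring

theorem weightedDerivs_convolution (s : Finset (ℕ × ℕ)) :
    weightedDerivs s (convolution (ContinuousLinearMap.mul ℂ ℂ) κ κ') =
      ∫ y, κ y • weightedDerivs s (compSubConstCLM ℂ y κ') := by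
  ext q m
  let eval := ContinuousMultilinearMap.apply ℝ (fun _ : Fin q.1.1.2 => E n) ℂ m ∘L
    lp.evalCLM ℝ (fun q : s × E n => E n [×q.1.1.2]→L[ℝ] ℂ) ⊤ q
  refine Eq.trans ?_
    (eval.integral_comp_comm (integrable_smul_weightedDerivs_compSubConstCLM κ κ' s))
  change ‖q.2‖ ^ q.1.1.1 • iteratedFDeriv ℝ q.1.1.2
    (convolution (ContinuousLinearMap.mul ℂ ℂ) κ κ') q.2 m = _
  rw [iteratedFDeriv_convolution_apply, ← integral_smul]
  refine integral_congr_ae (Eventually.of_forall fun y => ?_)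
  change _ = κ y • ‖q.2‖ ^ q.1.1.1 • iteratedFDeriv ℝ q.1.1.2 (compSubConstCLM ℂ y κ') q.2 m
  rw [iteratedFDeriv_compSubConstCLM, smul_comm]
  rfl

/-- By Hahn–Banach `v` factors through a normed space of derivatives, in which the convolution is
a Bochner integral of translates. -/
theorem apply_convolution (v : 𝓢'(E n, ℂ)) :
    v (convolution (ContinuousLinearMap.mul ℂ ℂ) κ κ') =
      ∫ y, κ y * v (compSubConstCLM ℂ y κ') := by
  obtain ⟨s, C, -, hC⟩ := exists_norm_le_sup_seminorm v
  obtain ⟨G, hG⟩ := exists_eq_comp_of_norm_le (v : 𝓢(E n, ℂ) →ₗ[ℂ] ℂ)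
    (weightedDerivs s).toLinearMap (C := C) fun f =>
      (hC f).trans_eq (by rw [ContinuousLinearMap.coe_coe, norm_weightedDerivs])
  have hG' (f : 𝓢(E n, ℂ)) : v f = G (weightedDerivs s f) := hG f
  rw [hG', weightedDerivs_convolution,
    ← G.integral_comp_comm (integrable_smul_weightedDerivs_compSubConstCLM κ κ' s)]
  simp only [map_smul, ← hG', smul_eq_mul]

theorem conv_convolution (v : 𝓢'(E n, ℂ)) (x : E n) :
    conv (convolution (ContinuousLinearMap.mul ℂ ℂ) κ κ') v x =
      ∫ y, κ y * conv κ' v (x - y) := by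
  let R : 𝓢(E n, ℂ) →L[ℂ] 𝓢(E n, ℂ) := compSubConstCLM ℂ x ∘L
    compCLMOfContinuousLinearEquiv ℂ (ContinuousLinearEquiv.neg ℝ (M := E n))
  refine (apply_convolution κ κ' (PointwiseConvergenceCLM.precomp ℂ R v)).trans ?_
  refine integral_congr_ae (Eventually.of_forall fun y => congrArg (κ y * ·) ?_)
  change v (reflectAt (compSubConstCLM ℂ y κ') x) = v (reflectAt κ' (x - y))
  congr 1
  ext z
  rw [reflectAt_apply, reflectAt_apply, compSubConstCLM_apply, sub_right_comm]

end ApplyConvolution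

section SymbolMul

variable {n : ℕ}

/-- The product of two symbols, whose Fourier multiplier is the composition of the two
multipliers. -/
def symbolMul (m m' : 𝓢(E n, ℂ)) : 𝓢(E n, ℂ) :=
  pairing (ContinuousLinearMap.mul ℂ ℂ) m m'

theorem symbolMul_apply (m m' : 𝓢(E n, ℂ)) (ξ : E n) : symbolMul m m' ξ = m ξ * m' ξ := rfl

theorem multiplier_symbolMul (v : 𝓢'(E n, ℂ)) (m m' : 𝓢(E n, ℂ)) (x : E n) :
    multiplier (symbolMul m m') v x = ∫ y, (𝓕⁻ m) y * multiplier m' v (x - y) := by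
  have hconv : 𝓕⁻ (symbolMul m m') =
      SchwartzMap.convolution (ContinuousLinearMap.mul ℂ ℂ) (𝓕⁻ m) (𝓕⁻ m') := by
    simp [symbolMul, SchwartzMap.convolution]
  rw [multiplier, hconv, conv_convolution]
  rfl

end SymbolMul

/-! ### Quasi-norm inequalities -/

section QuasiNorm

variable {p : ℝ}

theorem rpow_sum_le_sum_rpow {ι : Type*} (hp0 : 0 < p) (hp1 : p ≤ 1) (s : Finset ι)
    (a : ι → ℝ≥0∞) : (∑ i ∈ s, a i) ^ p ≤ ∑ i ∈ s, a i ^ p :=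
  Finset.le_sum_of_subadditive (· ^ p) (ENNReal.zero_rpow_of_pos hp0).le
    (fun a b => ENNReal.rpow_add_le_add_rpow a b hp0.le hp1) s a

theorem tsum_le_tsum_rpow {ι : Type*} (hp0 : 0 < p) (hp1 : p ≤ 1) (a : ι → ℝ≥0∞) :
    ∑' i, a i ≤ (∑' i, a i ^ p) ^ (1 / p) := by
  rw [ENNReal.tsum_eq_iSup_sum, one_div]
  exact iSup_le fun s => (ENNReal.le_rpow_inv_iff hp0).2
    ((rpow_sum_le_sum_rpow hp0 hp1 s a).trans (ENNReal.sum_le_tsum s))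

variable {α ε : Type*} [MeasurableSpace α] {μ : Measure α}

theorem eLpNorm_ofReal_eq [ENorm ε] (hp0 : 0 < p) (f : α → ε) :
    eLpNorm f (ENNReal.ofReal p) μ = (∫⁻ x, ‖f x‖ₑ ^ p ∂μ) ^ (1 / p) := by
  rw [eLpNorm_eq_lintegral_rpow_enorm_toReal (by simpa using hp0) ENNReal.ofReal_ne_top,
    ENNReal.toReal_ofReal hp0.le]

theorem eLpNorm_ofReal_rpow [ENorm ε] (hp0 : 0 < p) (f : α → ε) :
    eLpNorm f (ENNReal.ofReal p) μ ^ p = ∫⁻ x, ‖f x‖ₑ ^ p ∂μ := by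
  rw [eLpNorm_ofReal_eq hp0, one_div, ENNReal.rpow_inv_rpow hp0.ne']

theorem eLpNorm_le_of_enorm_le_tsum [ENorm ε] {ε' : Type*} [TopologicalSpace ε']
    [ContinuousENorm ε'] {ι : Type*} [Countable ι] (hp0 : 0 < p) (hp1 : p ≤ 1) {g : α → ε}
    {b : ι → α → ε'} (hb : ∀ i, AEStronglyMeasurable (b i) μ)
    (hg : ∀ᵐ x ∂μ, ‖g x‖ₑ ≤ ∑' i, ‖b i x‖ₑ) :
    eLpNorm g (ENNReal.ofReal p) μ ≤
      (∑' i, eLpNorm (b i) (ENNReal.ofReal p) μ ^ p) ^ (1 / p) := by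
  rw [eLpNorm_ofReal_eq hp0]
  gcongr
  simp only [eLpNorm_ofReal_rpow hp0]
  rw [← lintegral_tsum fun i => (hb i).enorm.pow_const p]
  refine lintegral_mono_ae (hg.mono fun x hx => ?_)
  rw [← ENNReal.le_rpow_inv_iff hp0, ← one_div]
  exact hx.trans (tsum_le_tsum_rpow hp0 hp1 _)

end QuasiNorm

/-! ### Fourier multipliers -/

section Multiplier

variable {n : ℕ}

theorem multiplier_sum {ι : Type*} (s : Finset ι) (m : ι → 𝓢(E n, ℂ)) (v : 𝓢'(E n, ℂ))
    (x : E n) : multiplier (∑ i ∈ s, m i) v x = ∑ i ∈ s, multiplier (m i) v x := by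
  have hsum : 𝓕⁻ (∑ i ∈ s, m i) = ∑ i ∈ s, 𝓕⁻ (m i) :=
    map_sum (fourierEquiv ℂ 𝓢(E n, ℂ)).symm m s
  simp only [multiplier, conv, reflectAt, hsum, map_sum]

theorem multiplier_zero (v : 𝓢'(E n, ℂ)) (x : E n) : multiplier 0 v x = 0 :=
  multiplier_sum ∅ (fun _ : Empty => 0) v x

theorem continuous_multiplier (m : 𝓢(E n, ℂ)) (v : 𝓢'(E n, ℂ)) :
    Continuous (multiplier m v) := continuous_conv _ _

theorem fourierInv_scale (m : 𝓢(E n, ℂ)) {t : ℝ} (ht : 0 < t) :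
    𝓕⁻ (scale t ht.ne' m) = approxId (𝓕⁻ m) t ht := by
  ext x
  rw [approxId_apply, fourierInv_coe, fourierInv_coe, Real.fourierInv_eq', Real.fourierInv_eq']
  have hsubst := Measure.integral_comp_smul (volume : Measure (E n))
    (fun v => Complex.exp (↑(2 * Real.pi * inner ℝ v (t⁻¹ • x)) * Complex.I) • m v) t
  rw [finrank_euclideanSpace, Fintype.card_fin, abs_of_pos (inv_pos.2 (pow_pos ht n)),
    Complex.real_smul] at hsubst
  rw [← hsubst]
  congr 1 with v
  rw [scale_apply, real_inner_smul_left, real_inner_smul_right, mul_inv_cancel_left₀ ht.ne']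

variable {V F : Type*} [NormedAddCommGroup V] [InnerProductSpace ℝ V] [FiniteDimensional ℝ V]
  [MeasurableSpace V] [BorelSpace V] [NormedAddCommGroup F] [NormedSpace ℂ F]

theorem integral_fourierInv [CompleteSpace F] (m : 𝓢(V, F)) : ∫ x, (𝓕⁻ m) x = m 0 := by
  have hzero : 𝓕 (𝓕⁻ m) (0 : V) = m 0 := by rw [fourier_fourierInv_eq]
  simpa only [fourier_coe, Real.fourier_eq, inner_zero_right, neg_zero, AddChar.map_zero_eq_one,
    one_smul] using hzero

theorem norm_fourierInv_compSubConstCLM (m : 𝓢(V, F)) (a x : V) :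
    ‖(𝓕⁻ (compSubConstCLM ℂ a m)) x‖ = ‖(𝓕⁻ m) x‖ := by
  have hmod : (𝓕⁻ (compSubConstCLM ℂ a m)) x =
      Complex.exp (↑(2 * Real.pi * inner ℝ a x) * Complex.I) • (𝓕⁻ m) x := by
    rw [fourierInv_coe, fourierInv_coe, Real.fourierInv_eq', Real.fourierInv_eq',
      ← integral_smul]
    conv_rhs => rw [← integral_sub_right_eq_self _ a]
    congr 1 with v
    rw [compSubConstCLM_apply, smul_smul, ← Complex.exp_add, inner_sub_left]
    congr 2
    push_cast
    ring
  rw [hmod, norm_smul, Complex.norm_exp_ofReal_mul_I, one_mul]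

end Multiplier

/-! ### Littlewood–Paley pieces dominate the function -/

theorem tendsto_two_pow_inv : Tendsto (fun j : ℕ => ((2 : ℝ) ^ j)⁻¹) atTop (𝓝 0) :=
  tendsto_inv_atTop_zero.comp (tendsto_pow_atTop_atTop_of_one_lt one_lt_two)

theorem two_pow_inv_le_one (j : ℕ) : ((2 : ℝ) ^ j)⁻¹ ≤ 1 :=
  inv_le_one_of_one_le₀ (one_le_pow₀ one_le_two)

section LowerBounds

variable {n : ℕ} {p : ℝ} {g : E n → ℂ} {v : 𝓢'(E n, ℂ)}

theorem eLpNorm_le_localHardyNorm (ψ : 𝓢(E n, ℂ)) (hψ : (∫ x, ψ x) ≠ 0) (p : ℝ)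
    (hgv : Represents g v) (hg : ∀ᵐ x, ContinuousAt g x) :
    eLpNorm g (ENNReal.ofReal p) volume ≤ ‖∫ x, ψ x‖ₑ⁻¹ * localHardyNorm ψ p v := by
  have hsmul : eLpNorm ((∫ x, ψ x) • g) (ENNReal.ofReal p) volume ≤ localHardyNorm ψ p v := by
    refine eLpNorm_mono_enorm_ae (hg.mono fun x hx => ?_)
    have ht (j : ℕ) : ((2 : ℝ) ^ (j + 1))⁻¹ ∈ Ioo (0 : ℝ) 1 :=
      ⟨by positivity, inv_lt_one_of_one_lt₀ (one_lt_pow₀ one_lt_two j.succ_ne_zero)⟩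
    have hlim := hgv.tendsto_conv_approxId hx ψ (fun j => (ht j).1) (fun j => (ht j).2.le)
      (tendsto_two_pow_inv.comp (tendsto_add_atTop_nat 1))
    rw [enorm_eq_self]
    exact le_of_tendsto hlim.enorm (Eventually.of_forall fun j =>
      le_iSup (fun t : Ioo (0 : ℝ) 1 => ‖conv (approxId ψ t t.2.1) v x‖ₑ) ⟨_, ht j⟩)
  rw [eLpNorm_const_smul, mul_comm] at hsmul
  rwa [← ENNReal.div_eq_inv_mul, ENNReal.le_div_iff_mul_le (by simp [hψ]) (by simp)]

namespace DyadicCutoff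

variable (φ : DyadicCutoff n)

theorem toSchwartz_zero : φ.toSchwartz 0 = 1 := by
  change ((φ.toFun 0 : ℝ) : ℂ) = 1
  rw [φ.eq_one 0 (by norm_num), Complex.ofReal_one]

theorem sum_piece (J : ℕ) :
    ∑ j ∈ Finset.range (J + 1), φ.piece j =
      scale ((2 : ℝ) ^ J)⁻¹ (by positivity) φ.toSchwartz := by
  induction J with
  | zero =>
    ext x
    simp [piece, scale_apply]
  | succ J ih =>
    have hscale : 2 * ((2 : ℝ) ^ (J + 1))⁻¹ = ((2 : ℝ) ^ J)⁻¹ := by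
      rw [pow_succ]
      field_simp
    rw [Finset.sum_range_succ, ih]
    ext x
    simp [piece, scale_apply, hscale]

theorem enorm_le_tsum_block (hgv : Represents g v) {x : E n} (hg : ContinuousAt g x) :
    ‖g x‖ₑ ≤ ∑' j, ‖φ.block j v x‖ₑ := by
  have ht (j : ℕ) : 0 < ((2 : ℝ) ^ j)⁻¹ := by positivity
  have hlim := hgv.tendsto_conv_approxId hg (𝓕⁻ φ.toSchwartz) ht two_pow_inv_le_one
    tendsto_two_pow_inv
  rw [integral_fourierInv, toSchwartz_zero, one_mul] at hlim
  have hpartial (J : ℕ) : conv (approxId (𝓕⁻ φ.toSchwartz) ((2 : ℝ) ^ J)⁻¹ (ht J)) v x =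
      ∑ j ∈ Finset.range (J + 1), φ.block j v x := by
    simp only [block]
    rw [← multiplier_sum, φ.sum_piece, multiplier, fourierInv_scale]
  refine le_of_tendsto hlim.enorm (Eventually.of_forall fun J => ?_)
  rw [hpartial]
  exact (enorm_sum_le _ _).trans (ENNReal.sum_le_tsum _)

theorem eLpNorm_le_besovNorm (hp0 : 0 < p) (hp1 : p ≤ 1) (hgv : Represents g v)
    (hg : ∀ᵐ x, ContinuousAt g x) :
    eLpNorm g (ENNReal.ofReal p) volume ≤ besovNorm φ p p v :=
  eLpNorm_le_of_enorm_le_tsum hp0 hp1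
    (fun _ => (continuous_multiplier _ v).aestronglyMeasurable)
    (hg.mono fun _ hx => φ.enorm_le_tsum_block hgv hx)

theorem eLpNorm_le_triebelLizorkinNorm (hp0 : 0 < p) (hp1 : p ≤ 1) (hgv : Represents g v)
    (hg : ∀ᵐ x, ContinuousAt g x) :
    eLpNorm g (ENNReal.ofReal p) volume ≤ triebelLizorkinNorm φ p p v := by
  refine eLpNorm_mono_enorm_ae (hg.mono fun x hx => ?_)
  rw [enorm_eq_self]
  exact (φ.enorm_le_tsum_block hgv hx).trans (tsum_le_tsum_rpow hp0 hp1 _)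

end DyadicCutoff

end LowerBounds

/-! ### Frequency-localized functions are bounded by their quasi-norms -/

section Reproducing

variable {V : Type*} [AddGroup V] {w u K : V → ℝ≥0∞} {M M₀ D : ℝ≥0∞} {p : ℝ}

theorem le_rpow_inv_of_le_rpow_mul (hp0 : 0 < p) (hM : M ≠ ⊤) (h : M ≤ M ^ (1 - p) * D) :
    M ≤ D ^ p⁻¹ := by
  rw [ENNReal.le_rpow_inv_iff hp0]
  rcases eq_or_ne M 0 with rfl | hM0
  · simp [hp0]
  have hcancel : M ^ (1 - p) * M ^ (p - 1) = 1 := by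
    rw [← ENNReal.rpow_add _ _ hM0 hM, sub_add_sub_cancel, sub_self, ENNReal.rpow_zero]
  calc M ^ p = M * M ^ (p - 1) := by
        conv_rhs => enter [1]; rw [← ENNReal.rpow_one M]
        rw [← ENNReal.rpow_add _ _ hM0 hM, add_sub_cancel]
    _ ≤ M ^ (1 - p) * D * M ^ (p - 1) := by gcongr
    _ = D := by rw [mul_right_comm, hcancel, one_mul]

theorem mul_comp_sub_le (hp0 : 0 ≤ p) (hp1 : p ≤ 1) (hw : ∀ x, 1 ≤ w x)
    (hsub : ∀ x y, w (x - y) ≤ w x * w y) (hu : ∀ x, u x ≤ M * w x) (hK : ∀ y, w y * K y ≤ D)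
    (x y : V) : K y * u (x - y) ≤ M ^ (1 - p) * w x * D * u (x - y) ^ p := by
  have hsplit : u (x - y) = u (x - y) ^ (1 - p) * u (x - y) ^ p := by
    rw [← ENNReal.rpow_add_of_nonneg _ _ (sub_nonneg.2 hp1) hp0, sub_add_cancel,
      ENNReal.rpow_one]
  have hgrowth : u (x - y) ^ (1 - p) ≤ M ^ (1 - p) * (w x * w y) :=
    calc u (x - y) ^ (1 - p) ≤ (M * w (x - y)) ^ (1 - p) :=
          ENNReal.rpow_le_rpow (hu _) (sub_nonneg.2 hp1)
      _ = M ^ (1 - p) * w (x - y) ^ (1 - p) := ENNReal.mul_rpow_of_nonneg _ _ (sub_nonneg.2 hp1)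
      _ ≤ M ^ (1 - p) * w (x - y) := by
          gcongr
          simpa using ENNReal.rpow_le_rpow_of_exponent_le (hw (x - y)) (sub_le_self 1 hp0)
      _ ≤ M ^ (1 - p) * (w x * w y) := by gcongr; exact hsub x y
  calc K y * u (x - y) = K y * (u (x - y) ^ (1 - p) * u (x - y) ^ p) := by rw [← hsplit]
    _ ≤ K y * (M ^ (1 - p) * (w x * w y) * u (x - y) ^ p) := by gcongr
    _ = M ^ (1 - p) * w x * (w y * K y) * u (x - y) ^ p := by ring
    _ ≤ M ^ (1 - p) * w x * D * u (x - y) ^ p := by gcongr; exact hK y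

variable [MeasurableSpace V] [MeasurableAdd V] [MeasurableNeg V] {μ : Measure V}
  [μ.IsAddLeftInvariant] [μ.IsNegInvariant]

/-- The best constant `M` in `u ≤ M * w` is finite, and inserting `u = u ^ (1 - p) * u ^ p` into
the convolution inequality bounds it by a multiple of `M ^ (1 - p)`. -/
theorem le_mul_of_le_lintegral_mul_comp_sub (hp0 : 0 < p) (hp1 : p ≤ 1) (hw : ∀ x, 1 ≤ w x)
    (hwt : ∀ x, w x ≠ ⊤) (hsub : ∀ x y, w (x - y) ≤ w x * w y) (hM₀ : M₀ ≠ ⊤)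
    (hgrow : ∀ x, u x ≤ M₀ * w x) (hD : D ≠ ⊤) (hK : ∀ y, w y * K y ≤ D)
    (hrep : ∀ x, u x ≤ ∫⁻ y, K y * u (x - y) ∂μ) (x : V) :
    u x ≤ (D * ∫⁻ z, u z ^ p ∂μ) ^ p⁻¹ * w x := by
  have hw0 (x : V) : w x ≠ 0 := (zero_lt_one.trans_le (hw x)).ne'
  set M := ⨆ x, u x / w x
  have hu (x : V) : u x ≤ M * w x :=
    (ENNReal.div_le_iff (hw0 x) (hwt x)).1 (le_iSup (fun x => u x / w x) x)
  have hM : M ≠ ⊤ := ne_top_of_le_ne_top hM₀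
    (iSup_le fun x => (ENNReal.div_le_iff (hw0 x) (hwt x)).2 (hgrow x))
  refine (hu x).trans ?_
  gcongr
  refine le_rpow_inv_of_le_rpow_mul hp0 hM
    (iSup_le fun x => (ENNReal.div_le_iff (hw0 x) (hwt x)).2 ?_)
  calc u x ≤ ∫⁻ y, K y * u (x - y) ∂μ := hrep x
    _ ≤ ∫⁻ y, M ^ (1 - p) * w x * D * u (x - y) ^ p ∂μ :=
        lintegral_mono (mul_comp_sub_le hp0.le hp1 hw hsub hu hK x)
    _ = M ^ (1 - p) * w x * D * ∫⁻ z, u z ^ p ∂μ := by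
        rw [lintegral_const_mul' _ _ (ENNReal.mul_ne_top (ENNReal.mul_ne_top
          (ENNReal.rpow_ne_top_of_nonneg (sub_nonneg.2 hp1) hM) (hwt x)) hD),
          lintegral_sub_left_eq_self (fun z => u z ^ p) x]
    _ = M ^ (1 - p) * (D * ∫⁻ z, u z ^ p ∂μ) * w x := by ring

end Reproducing

section FrequencyLocalized

variable {n : ℕ} {p : ℝ}

theorem enorm_multiplier_le_lintegral {m m' : 𝓢(E n, ℂ)} {a : E n}
    (hsym : symbolMul (compSubConstCLM ℂ a m) m' = m') (v : 𝓢'(E n, ℂ)) (x : E n) :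
    ‖multiplier m' v x‖ₑ ≤ ∫⁻ y, ‖(𝓕⁻ m) y‖ₑ * ‖multiplier m' v (x - y)‖ₑ := by
  conv_lhs => rw [← hsym, multiplier_symbolMul]
  refine (enorm_integral_le_lintegral_enorm _).trans_eq (lintegral_congr fun y => ?_)
  rw [enorm_mul, ← ofReal_norm, norm_fourierInv_compSubConstCLM, ofReal_norm]

theorem exists_enorm_multiplier_le (hp0 : 0 < p) (hp1 : p ≤ 1) (v : 𝓢'(E n, ℂ))
    (m : 𝓢(E n, ℂ)) :
    ∃ (N : ℕ) (D : ℝ), 0 ≤ D ∧ ∀ (a : E n) (m' : 𝓢(E n, ℂ)),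
      symbolMul (compSubConstCLM ℂ a m) m' = m' → ∀ x, ‖multiplier m' v x‖ₑ ≤
        ENNReal.ofReal (D * (1 + ‖x‖) ^ N) *
          eLpNorm (multiplier m' v) (ENNReal.ofReal p) volume := by
  obtain ⟨N, hN⟩ := exists_norm_conv_le_one_add_norm_pow v
  obtain ⟨D, hD0, hD⟩ := exists_one_add_norm_pow_mul_le (𝓕⁻ m) N
  refine ⟨N, D ^ p⁻¹, by positivity, fun a m' hsym x => ?_⟩
  obtain ⟨A, hA, hgrow⟩ := hN (𝓕⁻ m')
  refine (le_mul_of_le_lintegral_mul_comp_sub (w := fun x => ENNReal.ofReal ((1 + ‖x‖) ^ N))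
    (M₀ := ENNReal.ofReal A) (D := ENNReal.ofReal D) (K := fun y => ‖(𝓕⁻ m) y‖ₑ) hp0 hp1
    (fun x => ?_) (fun _ => ENNReal.ofReal_ne_top) (fun x y => ?_) ENNReal.ofReal_ne_top
    (fun x => ?_) ENNReal.ofReal_ne_top (fun y => ?_)
    (enorm_multiplier_le_lintegral hsym v) x).trans_eq ?_
  · rw [ENNReal.one_le_ofReal]
    exact one_le_pow₀ (le_add_of_nonneg_right (norm_nonneg x))
  · rw [← ENNReal.ofReal_mul (by positivity), ← mul_pow]
    gcongr
    exact one_add_norm_sub_le x y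
  · rw [← ENNReal.ofReal_mul hA, ← ofReal_norm]
    exact ENNReal.ofReal_le_ofReal (hgrow x)
  · rw [← ofReal_norm, ← ENNReal.ofReal_mul (by positivity)]
    exact ENNReal.ofReal_le_ofReal (hD y)
  · rw [ENNReal.mul_rpow_of_nonneg _ _ (by positivity), ENNReal.ofReal_rpow_of_nonneg hD0
      (by positivity), ← one_div p, ← eLpNorm_ofReal_eq hp0, ENNReal.ofReal_mul (by positivity)]
    ring

theorem multiplier_symbolMul_scale (v : 𝓢'(E n, ℂ)) (m m' : 𝓢(E n, ℂ)) {t : ℝ} (ht : 0 < t)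
    (x : E n) : multiplier (symbolMul (scale t ht.ne' m) m') v x =
      ∫ z, (𝓕⁻ m) z * multiplier m' v (x - t • z) := by
  rw [multiplier_symbolMul, fourierInv_scale m ht]
  exact integral_approxId_mul (𝓕⁻ m) ht fun y => multiplier m' v (x - y)

theorem tendsto_multiplier_symbolMul_scale (v : 𝓢'(E n, ℂ)) (m m' : 𝓢(E n, ℂ)) {t : ℕ → ℝ}
    (ht : ∀ j, 0 < t j) (ht1 : ∀ j, t j ≤ 1) (hlim : Tendsto t atTop (𝓝 0)) (x : E n) :
    Tendsto (fun j => multiplier (symbolMul (scale (t j) (ht j).ne' m) m') v x) atTop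
      (𝓝 (m 0 * multiplier m' v x)) := by
  obtain ⟨N, hN⟩ := exists_norm_conv_le_one_add_norm_pow v
  obtain ⟨A, -, hA⟩ := hN (𝓕⁻ m')
  simp only [multiplier_symbolMul_scale v m m' (ht _), ← integral_fourierInv m]
  exact tendsto_integral_mul_comp_sub_smul (continuous_multiplier m' v).aestronglyMeasurable hA
    (𝓕⁻ m) (continuous_multiplier m' v).continuousAt ht ht1 hlim

end FrequencyLocalized

/-! ### The uniform decomposition -/

theorem latticePoint_add {n : ℕ} (k l : Fin n → ℤ) :
    latticePoint (k + l) = latticePoint k + latticePoint l := by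
  ext i
  simp [latticePoint]

namespace UniformCutoff

variable {n : ℕ} (η : UniformCutoff n) {p : ℝ}

theorem piece_apply (k : Fin n → ℤ) (ξ : E n) :
    η.piece k ξ = ((η.window (ξ - latticePoint k) : ℝ) : ℂ) := rfl

theorem total_sub_latticePoint (ξ : E n) (k : Fin n → ℤ) :
    η.total (ξ - latticePoint k) = η.total ξ := by
  rw [total, total, ← (Equiv.addLeft k).tsum_eq fun l => η.toFun (ξ - latticePoint l)]
  congr 1 with l
  rw [Equiv.coe_addLeft, latticePoint_add, sub_add_eq_sub_sub]

theorem piece_eq_div_total (k : Fin n → ℤ) (ξ : E n) :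
    η.piece k ξ = ((η.toFun (ξ - latticePoint k) / η.total ξ : ℝ) : ℂ) := by
  rw [piece_apply, window, total_sub_latticePoint]

theorem piece_eq_zero_of_notMem_nearby {ξ₀ ξ : E n} (h : ξ ∈ Metric.ball ξ₀ 1) {k : Fin n → ℤ}
    (hk : k ∉ nearby ξ₀) : η.piece k ξ = 0 := by
  rw [piece_eq_div_total, η.eq_zero_of_notMem_nearby h hk, zero_div, Complex.ofReal_zero]

theorem sum_piece {F : Finset (Fin n → ℤ)} {ξ : E n} (hF : ∀ k ∉ F, η.piece k ξ = 0) :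
    ∑ k ∈ F, η.piece k ξ = 1 := by
  have htotal : η.total ξ ≠ 0 := (zero_lt_one.trans_le (η.one_le_total ξ)).ne'
  have hzero (k : Fin n → ℤ) (hk : k ∉ F) : η.toFun (ξ - latticePoint k) = 0 := by
    simpa [piece_eq_div_total, htotal] using hF k hk
  simp only [piece_eq_div_total]
  rw [← Complex.ofReal_sum, ← Finset.sum_div, ← tsum_eq_sum (L := .unconditional _) hzero]
  exact congrArg Complex.ofReal (div_self htotal)

theorem exists_finset_piece_eq_zero {S : Set (E n)} (hS : IsCompact S) :
    ∃ F : Finset (Fin n → ℤ), ∀ k ∉ F, ∀ ξ ∈ S, η.piece k ξ = 0 := by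
  obtain ⟨T, hST⟩ := hS.elim_finite_subcover (fun ξ₀ : E n => Metric.ball ξ₀ 1)
    (fun _ => Metric.isOpen_ball) fun ξ _ => mem_iUnion.2 ⟨ξ, Metric.mem_ball_self one_pos⟩
  classical
  refine ⟨T.biUnion nearby, fun k hk ξ hξ => ?_⟩
  obtain ⟨ξ₀, hξ₀, hball⟩ := mem_iUnion₂.1 (hST hξ)
  exact η.piece_eq_zero_of_notMem_nearby hball fun h => hk (Finset.mem_biUnion.2 ⟨ξ₀, hξ₀, h⟩)

theorem multiplier_eq_tsum (v : 𝓢'(E n, ℂ)) {m : 𝓢(E n, ℂ)} (hm : HasCompactSupport m)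
    (x : E n) : multiplier m v x = ∑' k, multiplier (symbolMul m (η.piece k)) v x := by
  obtain ⟨F, hF⟩ := η.exists_finset_piece_eq_zero hm.isCompact
  have hzero (k : Fin n → ℤ) (hk : k ∉ F) : symbolMul m (η.piece k) = 0 := by
    ext ξ
    rcases eq_or_ne (m ξ) 0 with h | h
    · rw [symbolMul_apply, h, zero_mul, zero_apply]
    · rw [symbolMul_apply, hF k hk ξ (subset_tsupport m h), mul_zero, zero_apply]
  have hsum : ∑ k ∈ F, symbolMul m (η.piece k) = m := by
    ext ξ
    simp only [sum_apply, symbolMul_apply, ← Finset.mul_sum]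
    rcases eq_or_ne (m ξ) 0 with h | h
    · rw [h, zero_mul]
    · rw [η.sum_piece fun k hk => hF k hk ξ (subset_tsupport m h), mul_one]
  rw [tsum_eq_sum fun k hk => by rw [hzero k hk, multiplier_zero], ← multiplier_sum, hsum]

theorem conv_approxId_eq_tsum (v : 𝓢'(E n, ℂ)) {m : 𝓢(E n, ℂ)} (hm : HasCompactSupport m) {t : ℝ}
    (ht : 0 < t) (x : E n) : conv (approxId (𝓕⁻ m) t ht) v x =
      ∑' k, multiplier (symbolMul (scale t ht.ne' m) (η.piece k)) v x := by
  have hscale : HasCompactSupport (scale t ht.ne' m) := by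
    have hcoe : ⇑(scale t ht.ne' m) = fun x => m (t • x) := funext fun _ => scale_apply ..
    rw [hcoe]
    exact hm.comp_smul ht.ne'
  rw [← fourierInv_scale m ht]
  exact η.multiplier_eq_tsum v hscale x

theorem exists_norm_block_le (hp0 : 0 < p) (hp1 : p ≤ 1) (v : 𝓢'(E n, ℂ)) :
    ∃ (N : ℕ) (D : ℝ), 0 ≤ D ∧ ∀ k, eLpNorm (η.block k v) (ENNReal.ofReal p) volume ≠ ⊤ → ∀ x,
      ‖η.block k v x‖ ≤
        D * (eLpNorm (η.block k v) (ENNReal.ofReal p) volume).toReal * (1 + ‖x‖) ^ N := by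
  obtain ⟨r, hr, hsupp⟩ := η.hasCompactSupport_window.isBounded.exists_pos_norm_le
  obtain ⟨N, D, hD, hle⟩ := exists_enorm_multiplier_le hp0 hp1 v
    (scale r⁻¹ (inv_pos.2 hr).ne' (bumpSchwartz n))
  refine ⟨N, D, hD, fun k hk x => ?_⟩
  have hsym : symbolMul (compSubConstCLM ℂ (latticePoint k)
      (scale r⁻¹ (inv_pos.2 hr).ne' (bumpSchwartz n))) (η.piece k) = η.piece k := by
    ext ξ
    rw [symbolMul_apply, compSubConstCLM_apply, scale_apply, piece_apply]
    rcases eq_or_ne (η.window (ξ - latticePoint k)) 0 with h | h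
    · rw [h, Complex.ofReal_zero, mul_zero]
    · rw [bumpSchwartz_eq_one, one_mul]
      rw [norm_smul, norm_inv, Real.norm_of_nonneg hr.le, inv_mul_le_one₀ hr]
      exact hsupp _ (subset_tsupport _ h)
  have hx := ENNReal.toReal_mono (ENNReal.mul_ne_top ENNReal.ofReal_ne_top hk)
    (hle (latticePoint k) (η.piece k) hsym x)
  rw [toReal_enorm, ENNReal.toReal_mul, ENNReal.toReal_ofReal (by positivity)] at hx
  exact hx.trans_eq (mul_right_comm _ _ _)

theorem eq_tsum_block (hp0 : 0 < p) (hp1 : p ≤ 1) {g : E n → ℂ} {v : 𝓢'(E n, ℂ)}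
    (hgv : Represents g v) {x : E n} (hg : ContinuousAt g x)
    (hfin : ∑' k, eLpNorm (η.block k v) (ENNReal.ofReal p) volume ^ p ≠ ⊤) :
    g x = ∑' k, η.block k v x := by
  obtain ⟨N, D, -, hD⟩ := η.exists_norm_block_le hp0 hp1 v
  set I : (Fin n → ℤ) → ℝ≥0∞ := fun k => eLpNorm (η.block k v) (ENNReal.ofReal p) volume
  have hI : ∑' k, I k ≠ ⊤ :=
    ne_top_of_le_ne_top (ENNReal.rpow_ne_top_of_nonneg (by positivity) hfin)
      (tsum_le_tsum_rpow hp0 hp1 I)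
  have ht (j : ℕ) : 0 < ((2 : ℝ) ^ j)⁻¹ := by positivity
  have hone : bumpSchwartz n 0 = 1 := bumpSchwartz_eq_one (by simp)
  have hlim := hgv.tendsto_conv_approxId hg (𝓕⁻ (bumpSchwartz n)) ht two_pow_inv_le_one
    tendsto_two_pow_inv
  simp only [η.conv_approxId_eq_tsum v hasCompactSupport_bumpSchwartz, integral_fourierInv,
    hone, one_mul] at hlim
  have hbound : Summable fun k => D * (I k).toReal * (1 + ‖x‖) ^ N *
      ∫ z, (1 + ‖z‖) ^ N * ‖(𝓕⁻ (bumpSchwartz n)) z‖ :=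
    (((ENNReal.summable_toReal hI).mul_left D).mul_right _).mul_right _
  have hterms : Tendsto (fun j => ∑' k, multiplier (symbolMul (scale ((2 : ℝ) ^ j)⁻¹ (ht j).ne'
      (bumpSchwartz n)) (η.piece k)) v x) atTop (𝓝 (∑' k, η.block k v x)) := by
    refine tendsto_tsum_of_dominated_convergence hbound (fun k => ?_)
      (Eventually.of_forall fun j k => ?_)
    · have hk := tendsto_multiplier_symbolMul_scale v (bumpSchwartz n) (η.piece k) ht
        two_pow_inv_le_one tendsto_two_pow_inv x
      rwa [hone, one_mul] at hk
    · rw [multiplier_symbolMul_scale v _ _ (ht j)]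
      exact norm_integral_mul_comp_sub_smul_le (hD k (ENNReal.ne_top_of_tsum_ne_top hI k)) (ht j)
        (two_pow_inv_le_one j) (𝓕⁻ (bumpSchwartz n)) x
  exact tendsto_nhds_unique hlim hterms

theorem eLpNorm_le_modulationNorm (hp0 : 0 < p) (hp1 : p ≤ 1) {g : E n → ℂ} {v : 𝓢'(E n, ℂ)}
    (hgv : Represents g v) (hg : ∀ᵐ x, ContinuousAt g x) :
    eLpNorm g (ENNReal.ofReal p) volume ≤ modulationNorm η p p v := by
  by_cases hfin : ∑' k, eLpNorm (η.block k v) (ENNReal.ofReal p) volume ^ p = ⊤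
  · rw [modulationNorm, hfin, ENNReal.top_rpow_of_pos (by positivity)]
    exact le_top
  refine eLpNorm_le_of_enorm_le_tsum hp0 hp1
    (fun _ => (continuous_multiplier _ v).aestronglyMeasurable) (hg.mono fun x hx => ?_)
  rw [η.eq_tsum_block hp0 hp1 hgv hx hfin]
  by_cases hs : Summable fun k => η.block k v x
  · exact enorm_tsum_le_tsum_enorm
  · rw [tsum_eq_zero_of_not_summable hs, enorm_zero]
    exact zero_le

end UniformCutoff

/-! ### Translation invariance of the quasi-norms -/

section TranslationInvariance

variable {n : ℕ}

theorem represents_coe (b : 𝓢(E n, ℂ)) : Represents b (b : 𝓢'(E n, ℂ)) := by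
  refine ⟨b.continuous.locallyIntegrable, fun χ _ => ?_⟩
  rw [SchwartzMap.coe_apply]
  simp only [smul_eq_mul, mul_comm]

theorem conv_coe (ψ b : 𝓢(E n, ℂ)) (x : E n) :
    conv ψ (b : 𝓢'(E n, ℂ)) x = ∫ z, ψ z * b (x - z) := by
  rw [conv, SchwartzMap.coe_apply,
    ← integral_sub_left_eq_self (fun y => reflectAt ψ x y • b y) volume x]
  simp only [reflectAt_apply, sub_sub_cancel, smul_eq_mul]

theorem conv_compSubConstCLM_coe (ψ b : 𝓢(E n, ℂ)) (a : E n) :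
    conv ψ (compSubConstCLM ℂ a b : 𝓢'(E n, ℂ)) = fun x => conv ψ (b : 𝓢'(E n, ℂ)) (x - a) := by
  ext x
  simp only [conv_coe, compSubConstCLM_apply, sub_right_comm]

theorem eLpNorm_comp_sub {G ε : Type*} [AddGroup G] [MeasurableSpace G] [MeasurableAdd G]
    [TopologicalSpace ε] [ContinuousENorm ε] (μ : Measure G) [μ.IsAddRightInvariant] (f : G → ε)
    (p : ℝ≥0∞) (a : G) : eLpNorm (fun x => f (x - a)) p μ = eLpNorm f p μ := by
  conv_rhs => rw [← (measurePreserving_sub_right μ a).map_eq]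
  exact ((MeasurableEquiv.subRight a).measurableEmbedding.eLpNorm_map_measure).symm

theorem localHardyNorm_compSubConstCLM (ψ b : 𝓢(E n, ℂ)) (p : ℝ) (a : E n) :
    localHardyNorm ψ p (compSubConstCLM ℂ a b : 𝓢'(E n, ℂ)) =
      localHardyNorm ψ p (b : 𝓢'(E n, ℂ)) := by
  simp only [localHardyNorm, conv_compSubConstCLM_coe]
  exact eLpNorm_comp_sub volume
    (fun x => ⨆ t : Ioo (0 : ℝ) 1, ‖conv (approxId ψ t t.2.1) (b : 𝓢'(E n, ℂ)) x‖ₑ) _ a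

theorem besovNorm_compSubConstCLM (φ : DyadicCutoff n) (b : 𝓢(E n, ℂ)) (p q : ℝ) (a : E n) :
    besovNorm φ p q (compSubConstCLM ℂ a b : 𝓢'(E n, ℂ)) = besovNorm φ p q (b : 𝓢'(E n, ℂ)) := by
  simp only [besovNorm, DyadicCutoff.block, multiplier, conv_compSubConstCLM_coe,
    eLpNorm_comp_sub volume]

theorem triebelLizorkinNorm_compSubConstCLM (φ : DyadicCutoff n) (b : 𝓢(E n, ℂ)) (p q : ℝ)
    (a : E n) : triebelLizorkinNorm φ p q (compSubConstCLM ℂ a b : 𝓢'(E n, ℂ)) =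
      triebelLizorkinNorm φ p q (b : 𝓢'(E n, ℂ)) := by
  simp only [triebelLizorkinNorm, DyadicCutoff.block, multiplier, conv_compSubConstCLM_coe]
  exact eLpNorm_comp_sub volume
    (fun x => (∑' j : ℕ, ‖φ.block j (b : 𝓢'(E n, ℂ)) x‖ₑ ^ q) ^ (1 / q)) _ a

theorem modulationNorm_compSubConstCLM (η : UniformCutoff n) (b : 𝓢(E n, ℂ)) (p q : ℝ)
    (a : E n) : modulationNorm η p q (compSubConstCLM ℂ a b : 𝓢'(E n, ℂ)) =
      modulationNorm η p q (b : 𝓢'(E n, ℂ)) := by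
  simp only [modulationNorm, UniformCutoff.block, multiplier, conv_compSubConstCLM_coe,
    eLpNorm_comp_sub volume]

end TranslationInvariance

/-! ### Schwartz functions have finite quasi-norms -/

section SymbolFamily

variable {V ι : Type*} [NormedAddCommGroup V] [NormedSpace ℝ V]

/-- The symbols `m k` have size `A k` up to a polynomial weight: every derivative of `m k` is
`O(A k * (1 + |ξ|) ^ L)`, uniformly in `k`. -/
structure IsSymbolFamily (m : ι → 𝓢(V, ℂ)) (A : ι → ℝ) (L : ℕ) : Prop where
  nonneg (k : ι) : 0 ≤ A k
  exists_norm_iteratedFDeriv_le (i : ℕ) : ∃ C, 0 ≤ C ∧ ∀ k ξ,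
    ‖iteratedFDeriv ℝ i (m k) ξ‖ ≤ C * A k * (1 + ‖ξ‖) ^ L

theorem isSymbolFamily_compSubConstCLM (σ : 𝓢(V, ℂ)) (a : ι → V) (L : ℕ) :
    IsSymbolFamily (fun k => compSubConstCLM ℂ (a k) σ) (fun k => ((1 + ‖a k‖) ^ L)⁻¹) L where
  nonneg k := by positivity
  exists_norm_iteratedFDeriv_le i := by
    obtain ⟨C, hC, h⟩ := exists_one_add_norm_pow_mul_iteratedFDeriv_le σ L i
    refine ⟨C, hC, fun k ξ => ?_⟩
    have hweight := one_add_norm_le_mul (a k) ξ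
    rw [norm_sub_rev] at hweight
    rw [iteratedFDeriv_compSubConstCLM, mul_right_comm, ← div_eq_mul_inv,
      le_div_iff₀ (by positivity)]
    calc ‖iteratedFDeriv ℝ i σ (ξ - a k)‖ * (1 + ‖a k‖) ^ L
        ≤ ‖iteratedFDeriv ℝ i σ (ξ - a k)‖ * ((1 + ‖ξ‖) * (1 + ‖ξ - a k‖)) ^ L := by gcongr
      _ = (1 + ‖ξ - a k‖) ^ L * ‖iteratedFDeriv ℝ i σ (ξ - a k)‖ * (1 + ‖ξ‖) ^ L := by
          rw [mul_pow]; ring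
      _ ≤ C * (1 + ‖ξ‖) ^ L := by gcongr; exact h _

end SymbolFamily

section Multiplier

variable {n : ℕ} {ι : Type*} {m : ι → 𝓢(E n, ℂ)} {A : ι → ℝ} {L : ℕ}

theorem IsSymbolFamily.exists_seminorm_symbolMul_le (hm : IsSymbolFamily m A L) (f : 𝓢(E n, ℂ))
    (a l : ℕ) :
    ∃ C, 0 ≤ C ∧ ∀ k, SchwartzMap.seminorm ℂ a l (symbolMul (m k) f) ≤ C * A k := by
  choose C hC0 hC using hm.exists_norm_iteratedFDeriv_le
  choose B hB0 hB using fun i => exists_one_add_norm_pow_mul_iteratedFDeriv_le f (a + L) i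
  have hnonneg : 0 ≤ ∑ i ∈ Finset.range (l + 1), (l.choose i : ℝ) * (C i * B (l - i)) :=
    Finset.sum_nonneg fun i _ => mul_nonneg (by positivity) (mul_nonneg (hC0 _) (hB0 _))
  refine ⟨_, hnonneg, fun k =>
    seminorm_le_bound ℂ a l _ (mul_nonneg hnonneg (hm.nonneg k)) fun ξ => ?_⟩
  have hleibniz : ‖iteratedFDeriv ℝ l (symbolMul (m k) f) ξ‖ ≤
      ∑ i ∈ Finset.range (l + 1), (l.choose i : ℝ) *
        ‖iteratedFDeriv ℝ i (m k) ξ‖ * ‖iteratedFDeriv ℝ (l - i) f ξ‖ :=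
    norm_iteratedFDeriv_mul_le (𝕜 := ℝ) ((m k).smooth ⊤) (f.smooth ⊤) ξ (by exact_mod_cast le_top)
  have hξ : ‖ξ‖ ≤ 1 + ‖ξ‖ := le_add_of_nonneg_left zero_le_one
  calc ‖ξ‖ ^ a * ‖iteratedFDeriv ℝ l (symbolMul (m k) f) ξ‖
      ≤ (1 + ‖ξ‖) ^ a * ∑ i ∈ Finset.range (l + 1), (l.choose i : ℝ) *
          (C i * A k * (1 + ‖ξ‖) ^ L) * ‖iteratedFDeriv ℝ (l - i) f ξ‖ := by
        refine mul_le_mul (by gcongr) (hleibniz.trans ?_) (norm_nonneg _) (by positivity)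
        gcongr
        exact hC _ _ _
    _ = ∑ i ∈ Finset.range (l + 1), (l.choose i : ℝ) *
          (C i * ((1 + ‖ξ‖) ^ (a + L) * ‖iteratedFDeriv ℝ (l - i) f ξ‖)) * A k := by
        rw [Finset.mul_sum]
        exact Finset.sum_congr rfl fun i _ => by rw [pow_add]; ring
    _ ≤ _ := by
        rw [Finset.sum_mul]
        gcongr with i
        · exact hm.nonneg k
        · exact hC0 i
        · exact hB _ _

theorem exists_norm_fourierInv_le {V : Type*} [NormedAddCommGroup V] [InnerProductSpace ℝ V]
    [FiniteDimensional ℝ V] [MeasurableSpace V] [BorelSpace V] (M : ℕ) :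
    ∃ (s : Finset (ℕ × ℕ)) (C : ℝ), 0 ≤ C ∧ ∀ (f : 𝓢(V, ℂ)) (x : V),
      (1 + ‖x‖) ^ M * ‖(𝓕⁻ f) x‖ ≤ C * ∑ i ∈ s, SchwartzMap.seminorm ℂ i.1 i.2 f := by
  set F := schwartzSeminormFamily ℂ V ℂ
  set T : 𝓢(V, ℂ) →L[ℂ] 𝓢(V, ℂ) := fourierInvCLM ℂ 𝓢(V, ℂ)
  obtain ⟨s, C, -, h⟩ := Seminorm.bound_of_continuous (schwartz_withSeminorms ℂ V ℂ)
    (((Finset.Iic (M, 0)).sup F).comp (T : 𝓢(V, ℂ) →ₗ[ℂ] 𝓢(V, ℂ)))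
    (((schwartz_withSeminorms ℂ V ℂ).finset_sups.continuous_seminorm _).comp T.continuous)
  refine ⟨s, 2 ^ M * C, by positivity, fun f x => ?_⟩
  have hweight := one_add_le_sup_seminorm_apply (𝕜 := ℂ) (m := (M, 0)) le_rfl le_rfl (𝓕⁻ f) x
  rw [norm_iteratedFDeriv_zero] at hweight
  have hsum := Seminorm.finset_sup_le_sum F s f
  simp only [FunLike.coe_sum, Finset.sum_apply] at hsum
  calc (1 + ‖x‖) ^ M * ‖(𝓕⁻ f) x‖ ≤ 2 ^ M * (Finset.Iic (M, 0)).sup F (𝓕⁻ f) := hweight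
    _ ≤ 2 ^ M * (C * s.sup F f) := by gcongr; exact h f
    _ ≤ 2 ^ M * (C * ∑ i ∈ s, SchwartzMap.seminorm ℂ i.1 i.2 f) := by gcongr; exact hsum
    _ = 2 ^ M * C * ∑ i ∈ s, SchwartzMap.seminorm ℂ i.1 i.2 f := (mul_assoc _ _ _).symm

theorem multiplier_coe (m b : 𝓢(E n, ℂ)) :
    multiplier m (b : 𝓢'(E n, ℂ)) = 𝓕⁻ (symbolMul m (𝓕 b)) := by
  have hconv : 𝓕⁻ (symbolMul m (𝓕 b)) =
      SchwartzMap.convolution (ContinuousLinearMap.mul ℂ ℂ) (𝓕⁻ m) b := by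
    simp [symbolMul, SchwartzMap.convolution]
  ext x
  rw [hconv, SchwartzMap.convolution_apply, multiplier, conv_coe]
  rfl

theorem IsSymbolFamily.exists_norm_multiplier_coe_le (hm : IsSymbolFamily m A L)
    (b : 𝓢(E n, ℂ)) (M : ℕ) :
    ∃ C, 0 ≤ C ∧ ∀ k x, ‖multiplier (m k) (b : 𝓢'(E n, ℂ)) x‖ ≤ C * A k / (1 + ‖x‖) ^ M := by
  obtain ⟨s, C, hC, h⟩ := exists_norm_fourierInv_le (V := E n) M
  choose B hB0 hB using fun i : ℕ × ℕ => hm.exists_seminorm_symbolMul_le (𝓕 b) i.1 i.2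
  refine ⟨C * ∑ i ∈ s, B i, mul_nonneg hC (Finset.sum_nonneg fun i _ => hB0 i), fun k x => ?_⟩
  rw [multiplier_coe, le_div_iff₀ (by positivity), mul_comm, mul_assoc, Finset.sum_mul]
  refine (h _ x).trans ?_
  gcongr with i
  exact hB i k

variable {p : ℝ}

theorem exists_lintegral_rpow_le {V : Type*} [NormedAddCommGroup V] [NormedSpace ℝ V]
    [FiniteDimensional ℝ V] [MeasurableSpace V] [BorelSpace V] (μ : Measure V)
    [μ.IsAddHaarMeasure] (hp0 : 0 < p) :
    ∃ (M : ℕ) (J : ℝ≥0∞), J ≠ ⊤ ∧ ∀ (C : ℝ) (F : V → ℝ≥0∞), 0 ≤ C →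
      (∀ x, F x ≤ ENNReal.ofReal (C / (1 + ‖x‖) ^ M)) →
      ∫⁻ x, F x ^ p ∂μ ≤ ENNReal.ofReal (C ^ p) * J := by
  obtain ⟨M, hM⟩ := exists_nat_gt (Module.finrank ℝ V / p)
  rw [div_lt_iff₀ hp0] at hM
  refine ⟨M, ∫⁻ x : V, ENNReal.ofReal ((1 + ‖x‖) ^ (-(M * p))) ∂μ,
    (finite_integral_one_add_norm hM).ne, fun C F hC hF => ?_⟩
  rw [← lintegral_const_mul' _ _ ENNReal.ofReal_ne_top]
  refine lintegral_mono fun x => (ENNReal.rpow_le_rpow (hF x) hp0.le).trans_eq ?_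
  have hx : 0 ≤ 1 + ‖x‖ := by positivity
  rw [ENNReal.ofReal_rpow_of_nonneg (by positivity) hp0.le, ← ENNReal.ofReal_mul (by positivity),
    Real.div_rpow hC (by positivity), Real.rpow_neg hx, Real.rpow_mul hx, Real.rpow_natCast,
    div_eq_mul_inv]

theorem IsSymbolFamily.lintegral_iSup_multiplier_coe_lt_top (hm : IsSymbolFamily m 1 L)
    (b : 𝓢(E n, ℂ)) (hp0 : 0 < p) :
    ∫⁻ x, (⨆ k, ‖multiplier (m k) (b : 𝓢'(E n, ℂ)) x‖ₑ) ^ p < ⊤ := by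
  obtain ⟨M, J, hJ, h⟩ := exists_lintegral_rpow_le (volume : Measure (E n)) hp0
  obtain ⟨C, hC, hb⟩ := hm.exists_norm_multiplier_coe_le b M
  refine (h C _ hC fun x => iSup_le fun k => ?_).trans_lt
    (ENNReal.mul_lt_top ENNReal.ofReal_lt_top hJ.lt_top)
  rw [← ofReal_norm]
  simpa using ENNReal.ofReal_le_ofReal (hb k x)

theorem IsSymbolFamily.tsum_lintegral_multiplier_coe_lt_top (hm : IsSymbolFamily m A L)
    (b : 𝓢(E n, ℂ)) (hp0 : 0 < p) (hA : Summable fun k => A k ^ p) :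
    ∑' k, ∫⁻ x, ‖multiplier (m k) (b : 𝓢'(E n, ℂ)) x‖ₑ ^ p < ⊤ := by
  obtain ⟨M, J, hJ, h⟩ := exists_lintegral_rpow_le (volume : Measure (E n)) hp0
  obtain ⟨C, hC, hb⟩ := hm.exists_norm_multiplier_coe_le b M
  have hterm (k : ι) : ∫⁻ x, ‖multiplier (m k) (b : 𝓢'(E n, ℂ)) x‖ₑ ^ p ≤
      ENNReal.ofReal (C ^ p * A k ^ p) * J := by
    rw [← Real.mul_rpow hC (hm.nonneg k)]
    refine h _ _ (mul_nonneg hC (hm.nonneg k)) fun x => ?_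
    rw [← ofReal_norm]
    exact ENNReal.ofReal_le_ofReal (hb k x)
  refine (ENNReal.tsum_le_tsum hterm).trans_lt ?_
  rw [ENNReal.tsum_mul_right]
  exact ENNReal.mul_lt_top (hA.mul_left _).tsum_ofReal_ne_top.lt_top hJ.lt_top

end Multiplier

section Finiteness

variable {n : ℕ} {p : ℝ}

theorem norm_iteratedFDeriv_scale_le (m : 𝓢(E n, ℂ)) {t : ℝ} (ht : 0 < t) (ht1 : t ≤ 1) (i : ℕ)
    (ξ : E n) : ‖iteratedFDeriv ℝ i (scale t ht.ne' m) ξ‖ ≤ SchwartzMap.seminorm ℝ 0 i m := by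
  have hcoe : ⇑(scale t ht.ne' m) = fun x => m (t • x) := rfl
  rw [hcoe, iteratedFDeriv_comp_const_smul _ (m.smooth i), norm_smul, norm_pow,
    Real.norm_of_nonneg ht.le]
  calc t ^ i * ‖iteratedFDeriv ℝ i m (t • ξ)‖ ≤ 1 * ‖iteratedFDeriv ℝ i m (t • ξ)‖ := by
        gcongr
        exact pow_le_one₀ ht.le ht1
    _ ≤ SchwartzMap.seminorm ℝ 0 i m := by
        simpa using SchwartzMap.le_seminorm ℝ 0 i m (t • ξ)

theorem isSymbolFamily_scale (m : 𝓢(E n, ℂ)) :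
    IsSymbolFamily (fun t : Ioo (0 : ℝ) 1 => scale (t : ℝ) t.2.1.ne' m) 1 0 where
  nonneg _ := zero_le_one
  exists_norm_iteratedFDeriv_le i := ⟨SchwartzMap.seminorm ℝ 0 i m, apply_nonneg _ _,
    fun t ξ => by simpa using norm_iteratedFDeriv_scale_le m t.2.1 t.2.2.le i ξ⟩

theorem localHardyNorm_coe_lt_top (ψ b : 𝓢(E n, ℂ)) (hp0 : 0 < p) :
    localHardyNorm ψ p (b : 𝓢'(E n, ℂ)) < ⊤ := by
  have hconv (t : Ioo (0 : ℝ) 1) : conv (approxId ψ t t.2.1) (b : 𝓢'(E n, ℂ)) =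
      multiplier (scale (t : ℝ) t.2.1.ne' (𝓕 ψ)) b := by
    rw [multiplier, fourierInv_scale, fourierInv_fourier_eq]
  simp only [localHardyNorm, hconv, eLpNorm_ofReal_eq hp0, enorm_eq_self]
  exact ENNReal.rpow_lt_top_of_nonneg (by positivity)
    ((isSymbolFamily_scale (𝓕 ψ)).lintegral_iSup_multiplier_coe_lt_top b hp0).ne

namespace DyadicCutoff

variable (φ : DyadicCutoff n)

theorem eventuallyEq_one_scale {t : ℝ} (ht : 0 < t) {ξ : E n} (h : t * ‖ξ‖ ≤ 1) :
    scale t ht.ne' φ.toSchwartz =ᶠ[𝓝 ξ] 1 := by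
  have hlt : ‖t • ξ‖ < 4 / 3 := by
    rw [norm_smul, Real.norm_of_nonneg ht.le]
    linarith
  filter_upwards [(continuous_const_smul t).norm.continuousAt.eventually_lt_const hlt] with ζ hζ
  change (φ.toFun (t • ζ) : ℂ) = 1
  rw [φ.eq_one _ hζ.le, Complex.ofReal_one]

/-- The `j`-th piece vanishes where `|ξ| < 2 ^ (j - 1)`, so that `1` may be traded for
`2 ^ (1 - j) * |ξ|` in the bounds for its derivatives. -/
theorem isSymbolFamily_piece : IsSymbolFamily φ.piece (fun j => ((2 : ℝ) ^ j)⁻¹) 1 where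
  nonneg j := by positivity
  exists_norm_iteratedFDeriv_le i := by
    set S := SchwartzMap.seminorm ℝ 0 i φ.toSchwartz
    have hS : 0 ≤ S := apply_nonneg _ _
    refine ⟨4 * S, by positivity, fun j ξ => ?_⟩
    rcases Nat.eq_zero_or_pos j with rfl | hj
    · have hle : ‖iteratedFDeriv ℝ i φ.toSchwartz ξ‖ ≤ S := by
        simpa using SchwartzMap.le_seminorm ℝ 0 i φ.toSchwartz ξ
      rw [piece, if_pos rfl, pow_zero, inv_one, mul_one, pow_one]
      nlinarith [mul_nonneg hS (norm_nonneg ξ)]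
    set s : ℝ := ((2 : ℝ) ^ j)⁻¹
    have hs : 0 < s := by positivity
    have hs1 : 2 * s ≤ 1 := by
      rw [← div_eq_mul_inv, div_le_one (by positivity)]
      exact le_self_pow₀ one_le_two hj.ne'
    have hpiece : ⇑(φ.piece j) = ⇑(scale s hs.ne' φ.toSchwartz) -
        ⇑(scale (2 * s) (by positivity) φ.toSchwartz) := by
      rw [piece, if_neg hj.ne']
      rfl
    rcases le_total (2 * s * ‖ξ‖) 1 with hξ | hξ
    · have hzero : φ.piece j =ᶠ[𝓝 ξ] 0 := by
        rw [hpiece]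
        filter_upwards [φ.eventuallyEq_one_scale hs (by nlinarith [norm_nonneg ξ]),
          φ.eventuallyEq_one_scale (by positivity : 0 < 2 * s) hξ] with ζ h h'
        rw [Pi.sub_apply, h, h', sub_self, Pi.zero_apply]
      rw [(hzero.iteratedFDeriv ℝ i).eq_of_nhds, iteratedFDeriv_zero, Pi.zero_apply, norm_zero]
      positivity
    · rw [hpiece, iteratedFDeriv_sub_apply ((scale s _ _).smooth i).contDiffAt
        ((scale (2 * s) _ _).smooth i).contDiffAt]
      have hle := norm_iteratedFDeriv_scale_le φ.toSchwartz hs (by linarith) i ξ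
      have hle' := norm_iteratedFDeriv_scale_le φ.toSchwartz (by positivity : 0 < 2 * s) hs1 i ξ
      refine (norm_sub_le _ _).trans ((add_le_add hle hle').trans ?_)
      nlinarith [mul_nonneg hS hs.le, mul_le_mul_of_nonneg_left hξ hS]

theorem tsum_lintegral_block_coe_lt_top (b : 𝓢(E n, ℂ)) (hp0 : 0 < p) :
    ∑' j, ∫⁻ x, ‖φ.block j (b : 𝓢'(E n, ℂ)) x‖ₑ ^ p < ⊤ := by
  refine φ.isSymbolFamily_piece.tsum_lintegral_multiplier_coe_lt_top b hp0 ?_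
  have hpow (j : ℕ) : (((2 : ℝ) ^ j)⁻¹) ^ p = (((2 : ℝ)⁻¹) ^ p) ^ j := by
    rw [← inv_pow, Real.rpow_pow_comm (by norm_num)]
  simp only [hpow]
  exact summable_geometric_of_lt_one (by positivity)
    (Real.rpow_lt_one (by norm_num) (by norm_num) hp0)

end DyadicCutoff

theorem besovNorm_coe_lt_top (φ : DyadicCutoff n) (b : 𝓢(E n, ℂ)) (hp0 : 0 < p) :
    besovNorm φ p p (b : 𝓢'(E n, ℂ)) < ⊤ := by
  simp only [besovNorm, eLpNorm_ofReal_rpow hp0]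
  exact ENNReal.rpow_lt_top_of_nonneg (by positivity) (φ.tsum_lintegral_block_coe_lt_top b hp0).ne

theorem triebelLizorkinNorm_coe_lt_top (φ : DyadicCutoff n) (b : 𝓢(E n, ℂ)) (hp0 : 0 < p) :
    triebelLizorkinNorm φ p p (b : 𝓢'(E n, ℂ)) < ⊤ := by
  have hmeas (j : ℕ) : Measurable fun x => ‖φ.block j (b : 𝓢'(E n, ℂ)) x‖ₑ ^ p :=
    (continuous_multiplier _ _).measurable.enorm.pow_const p
  rw [triebelLizorkinNorm, eLpNorm_ofReal_eq hp0]
  refine ENNReal.rpow_lt_top_of_nonneg (by positivity) ?_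
  simp only [enorm_eq_self, ← ENNReal.rpow_mul, one_div, inv_mul_cancel₀ hp0.ne', ENNReal.rpow_one]
  rw [lintegral_tsum fun j => (hmeas j).aemeasurable]
  exact (φ.tsum_lintegral_block_coe_lt_top b hp0).ne

theorem latticePoint_injective : Function.Injective (latticePoint (n := n)) := fun k l h => by
  ext i
  simpa [latticePoint] using congrArg (fun v : E n => v i) h

theorem summable_one_add_norm_latticePoint_rpow {r : ℝ} (hr : (n : ℝ) < r) :
    Summable fun k : Fin n → ℤ => (1 + ‖latticePoint k‖) ^ (-r) := by
  set Λ := Submodule.span ℤ (Set.range (EuclideanSpace.basisFun (Fin n) ℝ).toBasis)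
  have hmem (k : Fin n → ℤ) : latticePoint k ∈ Λ := by
    rw [Module.Basis.mem_span_iff_repr_mem]
    exact fun i => ⟨k i, by simp [latticePoint]⟩
  have hΛ : Summable fun z : Λ => ‖z‖ ^ (-r) := by
    refine ZLattice.summable_norm_rpow Λ (-r) ?_
    rw [ZLattice.rank ℝ, finrank_euclideanSpace_fin]
    linarith
  have hsum : Summable fun k : Fin n → ℤ => ‖latticePoint k‖ ^ (-r) :=
    hΛ.comp_injective (i := fun k : Fin n → ℤ => (⟨latticePoint k, hmem k⟩ : Λ))
      fun k l h => latticePoint_injective (congrArg Subtype.val h)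
  refine Summable.of_norm_bounded_eventually hsum ?_
  filter_upwards [(finite_singleton (0 : Fin n → ℤ)).compl_mem_cofinite] with k hk
  have hk0 : 0 < ‖latticePoint k‖ := norm_pos_iff.2 fun h0 => hk
    (latticePoint_injective (h0.trans (by ext i; simp [latticePoint])))
  rw [Real.norm_of_nonneg (by positivity)]
  exact Real.rpow_le_rpow_of_nonpos hk0 (le_add_of_nonneg_left zero_le_one)
    (neg_nonpos.2 (n.cast_nonneg.trans hr.le))

theorem modulationNorm_coe_lt_top (η : UniformCutoff n) (b : 𝓢(E n, ℂ)) (hp0 : 0 < p) :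
    modulationNorm η p p (b : 𝓢'(E n, ℂ)) < ⊤ := by
  obtain ⟨L, hL⟩ := exists_nat_gt ((n : ℝ) / p)
  rw [div_lt_iff₀ hp0] at hL
  simp only [modulationNorm, eLpNorm_ofReal_rpow hp0]
  refine ENNReal.rpow_lt_top_of_nonneg (by positivity)
    ((isSymbolFamily_compSubConstCLM η.windowSchwartz latticePoint
      L).tsum_lintegral_multiplier_coe_lt_top b hp0 ?_).ne
  have hpow (k : Fin n → ℤ) : (((1 + ‖latticePoint k‖) ^ L)⁻¹) ^ p =
      (1 + ‖latticePoint k‖) ^ (-(L * p)) := by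
    rw [Real.inv_rpow (by positivity), Real.rpow_neg (by positivity),
      Real.rpow_mul (by positivity), Real.rpow_natCast]
  simp only [hpow]
  exact summable_one_add_norm_latticePoint_rpow hL

end Finiteness

/-! ### Bounded Hausdorff operators vanish -/

/-- The properties of the quasi-norms of `h^p`, `M^{p,p}`, `B^{p,p}` and `F^{p,p}` which force a
bounded Hausdorff operator to vanish. The quasi-norm need only dominate the `L^p` quasi-norm on
almost everywhere continuous functions; images of test functions are continuous away from `0`. -/
structure IsAdmissibleQuasiNorm {n : ℕ} (p : ℝ) (N : 𝓢'(E n, ℂ) → ℝ≥0∞) : Prop where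
  map_zero : N 0 = 0
  map_coe_lt_top (b : 𝓢(E n, ℂ)) : N b < ⊤
  map_compSubConstCLM (b : 𝓢(E n, ℂ)) (a : E n) :
    N (compSubConstCLM ℂ a b : 𝓢(E n, ℂ)) = N b
  exists_eLpNorm_le : ∃ A : ℝ≥0∞, A ≠ ⊤ ∧ ∀ (g : E n → ℂ) (v : 𝓢'(E n, ℂ)), Represents g v →
    (∀ᵐ x, ContinuousAt g x) → eLpNorm g (ENNReal.ofReal p) volume ≤ A * N v

section Admissible

variable {n : ℕ} {p : ℝ}

theorem isAdmissibleQuasiNorm_localHardyNorm (hp0 : 0 < p) {ψ : 𝓢(E n, ℂ)}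
    (hψ : (∫ x, ψ x) ≠ 0) : IsAdmissibleQuasiNorm p (localHardyNorm ψ p) where
  map_zero := by
    have hconv (t : Ioo (0 : ℝ) 1) (x : E n) : conv (approxId ψ t t.2.1) 0 x = 0 := rfl
    simp only [localHardyNorm, hconv, enorm_zero, ENNReal.iSup_zero]
    exact eLpNorm_zero' (ε := ℝ≥0∞)
  map_coe_lt_top b := localHardyNorm_coe_lt_top ψ b hp0
  map_compSubConstCLM b a := localHardyNorm_compSubConstCLM ψ b p a
  exists_eLpNorm_le := ⟨‖∫ x, ψ x‖ₑ⁻¹, by simpa using hψ,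
    fun _ _ => eLpNorm_le_localHardyNorm ψ hψ p⟩

theorem isAdmissibleQuasiNorm_modulationNorm (hp0 : 0 < p) (hp1 : p ≤ 1) (η : UniformCutoff n) :
    IsAdmissibleQuasiNorm p (modulationNorm η p p) where
  map_zero := by
    have hblock (k : Fin n → ℤ) : η.block k 0 = 0 := rfl
    simp [modulationNorm, hblock, hp0]
  map_coe_lt_top b := modulationNorm_coe_lt_top η b hp0
  map_compSubConstCLM b a := modulationNorm_compSubConstCLM η b p p a
  exists_eLpNorm_le := ⟨1, ENNReal.one_ne_top, fun _ _ hgv hg =>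
    (one_mul (modulationNorm η p p _)).symm ▸ η.eLpNorm_le_modulationNorm hp0 hp1 hgv hg⟩

theorem isAdmissibleQuasiNorm_besovNorm (hp0 : 0 < p) (hp1 : p ≤ 1) (φ : DyadicCutoff n) :
    IsAdmissibleQuasiNorm p (besovNorm φ p p) where
  map_zero := by
    have hblock (j : ℕ) : φ.block j 0 = 0 := rfl
    simp [besovNorm, hblock, hp0]
  map_coe_lt_top b := besovNorm_coe_lt_top φ b hp0
  map_compSubConstCLM b a := besovNorm_compSubConstCLM φ b p p a
  exists_eLpNorm_le := ⟨1, ENNReal.one_ne_top, fun _ _ hgv hg =>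
    (one_mul (besovNorm φ p p _)).symm ▸ φ.eLpNorm_le_besovNorm hp0 hp1 hgv hg⟩

theorem isAdmissibleQuasiNorm_triebelLizorkinNorm (hp0 : 0 < p) (hp1 : p ≤ 1)
    (φ : DyadicCutoff n) : IsAdmissibleQuasiNorm p (triebelLizorkinNorm φ p p) where
  map_zero := by
    have hblock (j : ℕ) : φ.block j 0 = 0 := rfl
    simp [triebelLizorkinNorm, hblock, hp0]
  map_coe_lt_top b := triebelLizorkinNorm_coe_lt_top φ b hp0
  map_compSubConstCLM b a := triebelLizorkinNorm_compSubConstCLM φ b p p a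
  exists_eLpNorm_le := ⟨1, ENNReal.one_ne_top, fun _ _ hgv hg =>
    (one_mul (triebelLizorkinNorm φ p p _)).symm ▸
      φ.eLpNorm_le_triebelLizorkinNorm hp0 hp1 hgv hg⟩

end Admissible

section Characterization

variable {n : ℕ} {p : ℝ} {Φ : E n → ℂ} {𝒟 : Set (E n → ℂ)} {N : 𝓢'(E n, ℂ) → ℝ≥0∞}

theorem IsZeroOperator.boundedOnLp (hzero : IsZeroOperator Φ) (h𝒟 : 𝒟 ⊆ naturalDomain Φ) :
    BoundedOnLp p Φ 𝒟 :=
  ⟨0, fun f hf _ => ⟨MemLp.zero.ae_eq (hzero f (h𝒟 hf)).symm, by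
    rw [eLpNorm_congr_ae (hzero f (h𝒟 hf)), eLpNorm_zero]
    exact zero_le⟩⟩

theorem IsZeroOperator.boundedOn (hzero : IsZeroOperator Φ) (h𝒟 : 𝒟 ⊆ naturalDomain Φ)
    (hN : N 0 = 0) : BoundedOn N Φ 𝒟 := by
  refine ⟨0, fun f hf u _ _ => ⟨0, ⟨?_, fun χ _ => ?_⟩, by simp [hN], by simp [hN]⟩⟩
  · exact locallyIntegrable_zero.congr (hzero f (h𝒟 hf)).symm
  · refine (integral_eq_zero_of_ae ?_).symm
    filter_upwards [hzero f (h𝒟 hf)] with x hx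
    rw [hx, Pi.zero_apply, zero_mul]

variable [Nontrivial (E n)]

theorem boundedOnLp_iff_isZeroOperator (hp0 : 0 < p) (hp1 : p < 1)
    (hΦ : LocallyIntegrableOn Φ {0}ᶜ volume) (h𝒟 : testFunctions n ⊆ 𝒟)
    (h𝒟' : 𝒟 ⊆ naturalDomain Φ) : BoundedOnLp p Φ 𝒟 ↔ IsZeroOperator Φ := by
  refine ⟨fun ⟨C, hC⟩ => ?_, fun hzero => hzero.boundedOnLp h𝒟'⟩
  obtain ⟨e, he⟩ := exists_norm_eq (E n) zero_le_one
  have hmemLp (b : 𝓢(E n, ℂ)) : MemLp b (ENNReal.ofReal p) volume := b.memLp _ _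
  refine isZeroOperator_of_eLpNorm_hausdorff_le hΦ he (ENNReal.ofReal_pos.2 hp0).ne'
    (ENNReal.ofReal_lt_one.2 hp1)
    (C := C * eLpNorm (bumpSchwartz n) (ENNReal.ofReal p) volume)
    (ENNReal.mul_ne_top ENNReal.coe_ne_top (hmemLp (bumpSchwartz n)).2.ne) fun k hk => ?_
  refine (hC _ (h𝒟 (compSubConstCLM_bumpSchwartz_smul_mem_testFunctions he hk))
    (hmemLp _)).2.trans_eq ?_
  exact congrArg _ (eLpNorm_comp_sub volume (bumpSchwartz n) _ _)

theorem IsAdmissibleQuasiNorm.boundedOn_iff_isZeroOperator (hN : IsAdmissibleQuasiNorm p N)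
    (hp0 : 0 < p) (hp1 : p < 1) (hΦ : LocallyIntegrableOn Φ {0}ᶜ volume)
    (h𝒟 : testFunctions n ⊆ 𝒟) (h𝒟' : 𝒟 ⊆ naturalDomain Φ) :
    BoundedOn N Φ 𝒟 ↔ IsZeroOperator Φ := by
  refine ⟨fun ⟨C, hC⟩ => ?_, fun hzero => hzero.boundedOn h𝒟' hN.map_zero⟩
  obtain ⟨A, hA, hle⟩ := hN.exists_eLpNorm_le
  obtain ⟨e, he⟩ := exists_norm_eq (E n) zero_le_one
  refine isZeroOperator_of_eLpNorm_hausdorff_le hΦ he (ENNReal.ofReal_pos.2 hp0).ne'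
    (ENNReal.ofReal_lt_one.2 hp1) (C := A * (C * N (bumpSchwartz n)))
    (ENNReal.mul_ne_top hA (ENNReal.mul_ne_top ENNReal.coe_ne_top (hN.map_coe_lt_top _).ne))
    fun k hk => ?_
  have hmem := compSubConstCLM_bumpSchwartz_smul_mem_testFunctions he hk
  obtain ⟨v, hv, -, hvle⟩ := hC _ (h𝒟 hmem) _ (represents_coe _) (hN.map_coe_lt_top _)
  rw [hN.map_compSubConstCLM] at hvle
  have hcont : ∀ᵐ x, ContinuousAt (hausdorff Φ _) x := (Measure.ae_ne volume 0).mono fun x hx =>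
    (continuousOn_hausdorff hΦ hmem).continuousAt (isOpen_compl_singleton.mem_nhds hx)
  exact (hle _ v hv hcont).trans (mul_le_mul_right hvle A)

end Characterization

end Hausdorff

end

theorem mainTheorem4 (n : ℕ) (hn : 1 ≤ n) (p : ℝ) (hp0 : 0 < p) (hp1 : p < 1)
    (Φ : Hausdorff.E n → ℂ) (hΦ : LocallyIntegrableOn Φ {0}ᶜ volume)
    (𝒟 : Set (Hausdorff.E n → ℂ)) (h𝒟 : Hausdorff.testFunctions n ⊆ 𝒟)
    (h𝒟' : 𝒟 ⊆ Hausdorff.naturalDomain Φ)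
    (ψ : 𝓢(Hausdorff.E n, ℂ)) (hψ : (∫ x, ψ x) ≠ 0)
    (φ : Hausdorff.DyadicCutoff n) (η : Hausdorff.UniformCutoff n) :
    (Hausdorff.BoundedOnLp p Φ 𝒟 ↔ Hausdorff.IsZeroOperator Φ) ∧
    (Hausdorff.BoundedOn (Hausdorff.localHardyNorm ψ p) Φ 𝒟 ↔ Hausdorff.IsZeroOperator Φ) ∧
    (Hausdorff.BoundedOn (Hausdorff.modulationNorm η p p) Φ 𝒟 ↔ Hausdorff.IsZeroOperator Φ) ∧
    (Hausdorff.BoundedOn (Hausdorff.besovNorm φ p p) Φ 𝒟 ↔ Hausdorff.IsZeroOperator Φ) ∧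
    (Hausdorff.BoundedOn (Hausdorff.triebelLizorkinNorm φ p p) Φ 𝒟 ↔
      Hausdorff.IsZeroOperator Φ) := by
  have : NeZero n := ⟨(Nat.zero_lt_of_lt hn).ne'⟩
  exact ⟨Hausdorff.boundedOnLp_iff_isZeroOperator hp0 hp1 hΦ h𝒟 h𝒟',
    (Hausdorff.isAdmissibleQuasiNorm_localHardyNorm hp0 hψ).boundedOn_iff_isZeroOperator
      hp0 hp1 hΦ h𝒟 h𝒟',
    (Hausdorff.isAdmissibleQuasiNorm_modulationNorm hp0 hp1.le η).boundedOn_iff_isZeroOperator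
      hp0 hp1 hΦ h𝒟 h𝒟',
    (Hausdorff.isAdmissibleQuasiNorm_besovNorm hp0 hp1.le φ).boundedOn_iff_isZeroOperator
      hp0 hp1 hΦ h𝒟 h𝒟',
    (Hausdorff.isAdmissibleQuasiNorm_triebelLizorkinNorm hp0 hp1.le φ).boundedOn_iff_isZeroOperator
      hp0 hp1 hΦ h𝒟 h𝒟'⟩
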